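/- Let $\lambda_1>\lambda_2>\lambda_3>\lambda_4$ be real numbers with $\lambda_i+\lambda_j>0$ for $i\neq j$. Write the elements of $\mathfrak{so}(4)$ as $$M=\begin{bmatrix}0&-x_3&x_2&y_1\\x_3&0&-x_1&y_2\\-x_2&x_1&0&y_3\\-y_1&-y_2&-y_3&0\end{bmatrix},$$ and consider the free rigid body equation $\dot M=[M,\Omega]$, where $\Omega=[\omega_{ij}]$ is given by $m_{ij}=(\lambda_i+\lambda_j)\omega_{ij}$. It has the constants of motion $$H=-\tfrac14\operatorname{Trace}(M\Omega)=\tfrac12\Big(\tfrac{x_1^2}{\lambda_2+\lambda_3}+\tfrac{x_2^2}{\lambda_1+\lambda_3}+\tfrac{x_3^2}{\lambda_1+\lambda_2}+\tfrac{y_1^2}{\lambda_1+\lambda_4}+\tfrac{y_2^2}{\lambda_2+\lambda_4}+\tfrac{y_3^2}{\lambda_3+\lambda_4}\Big),$$ $$I=(\lambda_2^2+\lambda_3^2)x_1^2+(\lambda_1^2+\lambda_3^2)x_2^2+(\lambda_1^2+\lambda_2^2)x_3^2+(\lambda_1^2+\lambda_4^2)y_1^2+(\lambda_2^2+\lambda_4^2)y_2^2+(\lambda_3^2+\lambda_4^2)y_3^2,$$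 $$C_1=\tfrac12\sum_{i=1}^3(x_i^2+y_i^2),\qquad C_2=\sum_{i=1}^3x_iy_i.$$ Let $\alpha_1<\alpha_2$ be the roots (which are real and distinct) of $$\widetilde f(t)=(\lambda_1^2-\lambda_4^2)^2t^2-2\big[(\lambda_1^2-\lambda_2^2)(\lambda_3^2-\lambda_4^2)+(\lambda_1^2-\lambda_3^2)(\lambda_2^2-\lambda_4^2)\big]t+(\lambda_2^2-\lambda_3^2)^2 .$$ Let $c_1>0$ and $|c_2|<c_1$, let $\operatorname{Orb}_{c_1;c_2}=\{C_1=c_1,\ C_2=c_2\}$, and put $$a=\tfrac1{\sqrt2}\big(\sqrt{c_1+c_2}+\sqrt{c_1-c_2}\big),\qquad b=\tfrac1{\sqrt2}\big(\sqrt{c_1+c_2}-\sqrt{c_1-c_2}\big).$$ Let $M^1_{s,t}$ denote the element with $x_1=s$, $y_1=t$ and all other coordinates $0$. The points $M^1_{b,a}$ and $M^1_{-b,-a}$ are equilibria on $\operatorname{Orb}_{c_1;c_2}$. Let $M_e$ be either of them, and let $W=\ker dC_1(M_e)\cap\ker dC_2(M_e)$. (i) Suppose $b^2/a^2\in(\alpha_2,1)$.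 Then $M_e$ is nonlinearly (Lyapunov) stable, both on $\operatorname{Orb}_{c_1;c_2}$ and for the dynamics on all of $\mathfrak{so}(4)$. More precisely, the quadratic function $g(p)=S_3p^2+T_3p+U_3$ with $$S_3=(\lambda_1+\lambda_2)(\lambda_2+\lambda_4)(\lambda_2+\lambda_3)^2(a^2-b^2),$$ $$\begin{aligned}T_3=-(\lambda_2+\lambda_3)\big\{&(\lambda_2+\lambda_3)[(\lambda_1+\lambda_2)(\lambda_2+\lambda_4)+(\lambda_1+\lambda_3)(\lambda_3+\lambda_4)]a^2\\&-(\lambda_1+\lambda_4)[(\lambda_1+\lambda_2)(\lambda_1+\lambda_3)+(\lambda_2+\lambda_4)(\lambda_3+\lambda_4)]b^2\big\},\end{aligned}$$ $$U_3=(\lambda_1+\lambda_3)(\lambda_3+\lambda_4)[(\lambda_2+\lambda_3)^2a^2-(\lambda_1+\lambda_4)^2b^2]$$ has two distinct real roots $p_3<p_4$ and is negative exactly on $(p_3,p_4)$. For every $p\in(p_3,p_4)$ there are real $m,n$ such that $$F^p_{mn}=H+\frac{p}{2(\lambda_1+\lambda_3)(\lambda_1+\lambda_4)(\lambda_3+\lambda_4)}\,I+mC_1+nC_2$$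 satisfies $dF^p_{mn}(M_e)=0$; and for all such $m,n$ the Hessian $d^2F^p_{mn}(M_e)|_{W\times W}$ is positive definite and $F^p_{mn}$ is a Lyapunov function at $M_e$ on $\operatorname{Orb}_{c_1;c_2}$ (it does not increase along the motion, and $M_e$ is a strict local minimum of its restriction to the orbit). (ii) Suppose $b^2/a^2=\alpha_2$. Then $M_e$ is spectrally stable (no eigenvalue of the linearization at $M_e$ has positive real part), but its stability cannot be decided from the Hessian of a linear combination of $H,I,C_1,C_2$: for all real $\mu_1,\mu_2,m,n$ such that $F=\mu_1H+\mu_2I+mC_1+nC_2$ satisfies $dF(M_e)=0$, the form $d^2F(M_e)|_{W\times W}$ is neither positive definite nor negative definite. (iii) Suppose $b^2/a^2\in[0,\alpha_2)$. Then $M_e$ is not Lyapunov stable on $\operatorname{Orb}_{c_1;c_2}$, and hence not on $\mathfrak{so}(4)$. -/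

import Mathlib

namespace SO4RigidBody

/-- The Lie algebra `so(4)` in the coordinates `(x₁, x₂, x₃, y₁, y₂, y₃)` of the matrix
representation `so4Matrix` below: entries `0, 1, 2` are `x₁, x₂, x₃`, entries `3, 4, 5` are
`y₁, y₂, y₃`. -/
abbrev So4 : Type := EuclideanSpace ℝ (Fin 6)

/-- The skew-symmetric `4 × 4` matrix with coordinates `(x₁, x₂, x₃, y₁, y₂, y₃)`. -/
def so4Matrix (M : So4) : Matrix (Fin 4) (Fin 4) ℝ :=
  !![0, -M 2, M 1, M 3;
     M 2, 0, -M 0, M 4;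
     -M 1, M 0, 0, M 5;
     -M 3, -M 4, -M 5, 0]

/-- The angular velocity `Ω`, determined by `m_{ij} = (λ_i + λ_j) ω_{ij}`. The parameters
`λ₁, λ₂, λ₃, λ₄` are `l 0, l 1, l 2, l 3`. -/
noncomputable def angularVelocity (l : Fin 4 → ℝ) (M : So4) : Matrix (Fin 4) (Fin 4) ℝ :=
  Matrix.of fun i j => so4Matrix M i j / (l i + l j)

/-- The vector field of the free rigid body on `so(4)`. -/
noncomputable def rigidBodyField (l : Fin 4 → ℝ) (M : So4) : So4 :=
  !₂[(1 / (l 0 + l 1) - 1 / (l 0 + l 2)) * M 1 * M 2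
        + (1 / (l 2 + l 3) - 1 / (l 1 + l 3)) * M 4 * M 5,
     (1 / (l 1 + l 2) - 1 / (l 0 + l 1)) * M 0 * M 2
        + (1 / (l 0 + l 3) - 1 / (l 2 + l 3)) * M 3 * M 5,
     (1 / (l 0 + l 2) - 1 / (l 1 + l 2)) * M 0 * M 1
        + (1 / (l 1 + l 3) - 1 / (l 0 + l 3)) * M 3 * M 4,
     (1 / (l 2 + l 3) - 1 / (l 0 + l 2)) * M 1 * M 5
        + (1 / (l 0 + l 1) - 1 / (l 1 + l 3)) * M 2 * M 4,
     (1 / (l 1 + l 2) - 1 / (l 2 + l 3)) * M 0 * M 5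
        + (1 / (l 0 + l 3) - 1 / (l 0 + l 1)) * M 2 * M 3,
     (1 / (l 1 + l 3) - 1 / (l 1 + l 2)) * M 0 * M 4
        + (1 / (l 0 + l 2) - 1 / (l 0 + l 3)) * M 1 * M 3]

/-- The Hamiltonian `H`. -/
noncomputable def hamiltonian (l : Fin 4 → ℝ) (M : So4) : ℝ :=
  1 / 2 * (1 / (l 1 + l 2) * M 0 ^ 2 + 1 / (l 0 + l 2) * M 1 ^ 2 + 1 / (l 0 + l 1) * M 2 ^ 2
    + 1 / (l 0 + l 3) * M 3 ^ 2 + 1 / (l 1 + l 3) * M 4 ^ 2 + 1 / (l 2 + l 3) * M 5 ^ 2)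

/-- Mishchenko's additional constant of motion `I`. -/
def mishchenko (l : Fin 4 → ℝ) (M : So4) : ℝ :=
  (l 1 ^ 2 + l 2 ^ 2) * M 0 ^ 2 + (l 0 ^ 2 + l 2 ^ 2) * M 1 ^ 2 + (l 0 ^ 2 + l 1 ^ 2) * M 2 ^ 2
    + (l 0 ^ 2 + l 3 ^ 2) * M 3 ^ 2 + (l 1 ^ 2 + l 3 ^ 2) * M 4 ^ 2
    + (l 2 ^ 2 + l 3 ^ 2) * M 5 ^ 2

/-- The Casimir function `C₁`. -/
noncomputable def casimir₁ (M : So4) : ℝ :=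
  1 / 2 * (M 0 ^ 2 + M 1 ^ 2 + M 2 ^ 2 + M 3 ^ 2 + M 4 ^ 2 + M 5 ^ 2)

/-- The Casimir function `C₂`. -/
def casimir₂ (M : So4) : ℝ :=
  M 0 * M 3 + M 1 * M 4 + M 2 * M 5

/-- The coordinates parametrize exactly the skew-symmetric matrices. -/
theorem exists_so4Matrix_eq_iff (A : Matrix (Fin 4) (Fin 4) ℝ) :
    (∃ M : So4, so4Matrix M = A) ↔ A.transpose = -A := by
  constructor
  · rintro ⟨M, rfl⟩
    ext i j
    fin_cases i <;> fin_cases j <;> simp [so4Matrix]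
  · intro h
    have e : ∀ i j, A j i = -A i j := fun i j => congrFun (congrFun h i) j
    have d : ∀ i, A i i = 0 := fun i => by linarith [e i i]
    refine ⟨!₂[A 2 1, A 0 2, A 1 0, A 0 3, A 1 3, A 2 3], ?_⟩
    ext i j
    fin_cases i <;> fin_cases j <;>
      simp [so4Matrix, d, e 0 1, e 0 2, e 0 3, e 1 2, e 1 3, e 2 3]

/-- The vector field is that of the rigid body equation `Ṁ = [M, Ω]`. -/
theorem so4Matrix_rigidBodyField (l : Fin 4 → ℝ) (M : So4) :
    so4Matrix (rigidBodyField l M)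
      = so4Matrix M * angularVelocity l M - angularVelocity l M * so4Matrix M := by
  have c : ∀ i j, l i + l j = l j + l i := fun i j => add_comm _ _
  ext i j
  simp only [Matrix.sub_apply, Matrix.mul_apply, Fin.sum_univ_four, angularVelocity,
    Matrix.of_apply]
  fin_cases i <;> fin_cases j <;>
    simp [so4Matrix, rigidBodyField, c 1 0, c 2 0, c 3 0, c 2 1, c 3 1, c 3 2] <;> ring

/-- The Hamiltonian is `H = - Trace(M Ω) / 4`. -/
theorem hamiltonian_eq_trace (l : Fin 4 → ℝ) (M : So4) :
    hamiltonian l M = -(1 / 4) * (so4Matrix M * angularVelocity l M).trace := by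
  have c : ∀ i j, l i + l j = l j + l i := fun i j => add_comm _ _
  simp only [Matrix.trace, Matrix.diag, Matrix.mul_apply, Fin.sum_univ_four, angularVelocity,
    Matrix.of_apply]
  simp [so4Matrix, hamiltonian, c 1 0, c 2 0, c 3 0, c 2 1, c 3 1, c 3 2]
  ring

/-- The adjoint orbit `Orb_{c₁;c₂}`. -/
def orbit (c₁ c₂ : ℝ) : Set So4 :=
  {M | casimir₁ M = c₁ ∧ casimir₂ M = c₂}

/-- The element `M¹_{s,t}` of the Cartan subalgebra `t₁`: `x₁ = s`, `y₁ = t`, and all other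
coordinates vanish. -/
def equilibrium₁ (s t : ℝ) : So4 :=
  !₂[s, 0, 0, t, 0, 0]

/-- The value of `a` on the orbit `Orb_{c₁;c₂}`. -/
noncomputable def orbitA (c₁ c₂ : ℝ) : ℝ :=
  1 / √2 * (√(c₁ + c₂) + √(c₁ - c₂))

/-- The value of `b` on the orbit `Orb_{c₁;c₂}`. -/
noncomputable def orbitB (c₁ c₂ : ℝ) : ℝ :=
  1 / √2 * (√(c₁ + c₂) - √(c₁ - c₂))

/-- The quadratic function whose roots are `α₁ < α₂`. -/
def bifurcationQuadratic (l : Fin 4 → ℝ) (t : ℝ) : ℝ :=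
  (l 0 ^ 2 - l 3 ^ 2) ^ 2 * t ^ 2
    + (-2 * ((l 0 ^ 2 - l 1 ^ 2) * (l 2 ^ 2 - l 3 ^ 2)
        + (l 0 ^ 2 - l 2 ^ 2) * (l 1 ^ 2 - l 3 ^ 2))) * t
    + (l 1 ^ 2 - l 2 ^ 2) ^ 2

/-- The quadratic function `g` whose roots are `p₃ < p₄`. -/
def lyapunovQuadratic (l : Fin 4 → ℝ) (a b p : ℝ) : ℝ :=
  (l 0 + l 1) * (l 1 + l 3) * (l 1 + l 2) ^ 2 * (a ^ 2 - b ^ 2) * p ^ 2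
    + (-(l 1 + l 2) *
        ((l 1 + l 2) * ((l 0 + l 1) * (l 1 + l 3) + (l 0 + l 2) * (l 2 + l 3)) * a ^ 2
          - (l 0 + l 3) * ((l 0 + l 1) * (l 0 + l 2) + (l 1 + l 3) * (l 2 + l 3)) * b ^ 2)) * p
    + (l 0 + l 2) * (l 2 + l 3) * ((l 1 + l 2) ^ 2 * a ^ 2 - (l 0 + l 3) ^ 2 * b ^ 2)

/-- The linear combination `μ₁ H + μ₂ I + m C₁ + n C₂` of the constants of motion. -/
noncomputable def energyFunction (l : Fin 4 → ℝ) (μ₁ μ₂ m n : ℝ) (M : So4) : ℝ :=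
  μ₁ * hamiltonian l M + μ₂ * mishchenko l M + m * casimir₁ M + n * casimir₂ M

/-- The function `F^p_{mn} = H + p / (2 (λ₁+λ₃) (λ₁+λ₄) (λ₃+λ₄)) I + m C₁ + n C₂`. -/
noncomputable def lyapunovCandidate (l : Fin 4 → ℝ) (p m n : ℝ) : So4 → ℝ :=
  energyFunction l 1 (p / (2 * (l 0 + l 2) * (l 0 + l 3) * (l 2 + l 3))) m n

/-- The space `W = ker dC₁(M) ∩ ker dC₂(M)`. -/
noncomputable def casimirKernel (M : So4) : Submodule ℝ So4 :=
  (fderiv ℝ casimir₁ M).toLinearMap.ker ⊓ (fderiv ℝ casimir₂ M).toLinearMap.ker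

/-- The Hessian `d²F(M)` is positive definite on the subspace `W`. -/
def HessianPosDefOn (F : So4 → ℝ) (M : So4) (W : Submodule ℝ So4) : Prop :=
  ∀ w ∈ W, w ≠ 0 → 0 < fderiv ℝ (fderiv ℝ F) M w w

/-- The Hessian `d²F(M)` is negative definite on the subspace `W`. -/
def HessianNegDefOn (F : So4 → ℝ) (M : So4) (W : Submodule ℝ So4) : Prop :=
  ∀ w ∈ W, w ≠ 0 → fderiv ℝ (fderiv ℝ F) M w w < 0

/-- `F` is a Lyapunov function at `M` for the flow of `X` on the set `S`: it does not increase
along `X`, and `M` is a strict local minimum of its restriction to `S`. -/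
def IsLyapunovFunctionOn (F : So4 → ℝ) (X : So4 → So4) (S : Set So4) (M : So4) : Prop :=
  Differentiable ℝ F ∧ (∀ N ∈ S, fderiv ℝ F N (X N) ≤ 0) ∧
    ∃ ε > 0, ∀ N ∈ S, N ≠ M → dist N M < ε → F M < F N

/-- Nonlinear (that is, Lyapunov) stability of `M` for the trajectories of `X` starting
in `S`. -/
def IsNonlinearlyStableOn (X : So4 → So4) (S : Set So4) (M : So4) : Prop :=
  ∀ ε > 0, ∃ δ > 0, ∀ γ : ℝ → So4,
    IsIntegralCurveOn γ (fun _ => X) (Set.Ici 0) → γ 0 ∈ S → dist (γ 0) M < δ →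
      ∀ t ≥ 0, dist (γ t) M < ε

/-- Spectral stability of the equilibrium `M` of `X`: no complex eigenvalue of the linearization
of `X` at `M` has positive real part. -/
def IsSpectrallyStable (X : So4 → So4) (M : So4) : Prop :=
  ∀ z : ℂ, ((fderiv ℝ X M).toLinearMap.charpoly.map (algebraMap ℝ ℂ)).IsRoot z → z.re ≤ 0

end SO4RigidBody

open SO4RigidBody

/-!
The theorem rests on the pair of planes `ξ = (x₂, y₂)`, `η = (x₃, y₃)` transverse to the
equilibrium. Along any solution they satisfy, without approximation, `ξ' = P(x₁, y₁) η` and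
`η' = Q(x₁, y₁) ξ` with matrices `P`, `Q` linear in `x₁, y₁`. On the other side, every combination
of the constants of motion is a quadratic form, its Hessian on `W` is the sum of one form in `ξ` and
one in `η`, and both the Hessian and the pair `P, Q` are governed by the ratio `r = b² / a²`.

*Hessians.* Put `uᵢ = λᵢ²`. At a critical point the entries of the two blocks are combinations of
second divided differences of one function at the nodes `uᵢ`, and these divided differences are
proportional to `w - uᵢ` for a parameter `w` that is affine in `p`. Both determinants are positive
multiples of `r (w - u₁)(w - u₄) - (w - u₂)(w - u₃)` (`energyCoeff_det`), which is a negative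
multiple of `g(p)` (`lyapunovQuadratic_eq`). As a quadratic in `w` it has discriminant `f̃(r)`
(`bifurcationQuadratic_eq_discrim`). For `r > α₂` its positivity forces `w` outside `[u₄, u₁]`
(`pencilParameter_outside`), where the diagonal entries are positive (`divided_diff_pos`); for
`r = α₂` the discriminant vanishes and no combination is definite (`not_definite_of_ratio_eq`).
Stability on all of `so(4)` follows by adding to the energy a large multiple of the squared
deviations of the Casimir functions (`penalizedEnergy_growth`,
`isNonlinearlyStableOn_of_conserved`).

*Spectrum.* The nonzero eigenvalues `z` of the linearization satisfy
`z⁴ - tr(Q P) z² + det(Q P) = 0` (`eigenvalue_linearization`). The determinant is an explicit square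
`δ²`, and `tr(Q P) + 2 δ` vanishes exactly at `r = α₂` (`bifurcationRoot₂_mul`). So for `r = α₂`
all `z²` are equal to `-δ ≤ 0`. For `r < α₂` one has `δ > 0` and `tr(Q P) + 2 δ > 0`, so `Q P` has
no eigenvalue in `(-∞, 0]`; its square root then yields a bilinear form in `ξ, η` that increases
along the linearized flow (`exists_increasing_form`). Since the transverse equations are linear in
`ξ, η`, this form serves as a Chetaev function on a whole neighborhood. It is positive at points of
the orbit arbitrarily near the equilibrium (`exists_orbit_point_near`), and the solutions from
there, which exist for all times because the norm is conserved, must leave the neighborhood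
(`exists_le_dist_of_chetaev`).
-/

namespace SO4RigidBody

/-! ### Global existence of solutions, Lyapunov and Chetaev criteria -/

open scoped NNReal in
/-- A bounded `C¹` vector field has global integral curves. By boundedness a single application of
the Picard-Lindelöf theorem reaches every given time. -/
theorem exists_isIntegralCurve_of_bounded {E : Type*} [NormedAddCommGroup E] [NormedSpace ℝ E]
    [ProperSpace E] {v : E → E} (hv : ContDiff ℝ 1 v) {B : ℝ} (hB : ∀ x, ‖v x‖ ≤ B) (x : E) :
    ∃ γ : ℝ → E, γ 0 = x ∧ IsIntegralCurve γ (fun _ => v) := by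
  have hE : CompleteSpace E := inferInstance
  have key := (exists_isMIntegralCurve_iff_exists_isMIntegralCurveOn_Ioo
    (I := modelWithCornersSelf ℝ E) (v := v) (contMDiff_vectorSpace_iff_contDiff.2 hv) x).2 ?_
  · obtain ⟨γ, h0, hγ⟩ := key
    refine ⟨γ, h0, fun t => ?_⟩
    have h : HasFDerivAt γ ((1 : ℝ →L[ℝ] ℝ).smulRight (v (γ t))) t := (hγ t).hasFDerivAt
    exact h.hasDerivAt.congr_deriv (by simp)
  intro a
  rcases le_or_gt a 0 with ha | ha
  · exact ⟨fun _ => x, rfl, fun t ht => by have := ht.1.trans ht.2; linarith⟩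
  set B' : ℝ≥0 := Real.toNNReal B with hB'
  have hBB : B ≤ B' := Real.le_coe_toNNReal B
  set R : ℝ≥0 := B' * Real.toNNReal a with hR
  obtain ⟨K, hK⟩ := hv.locallyLipschitz.locallyLipschitzOn.exists_lipschitzOnWith_of_compact
    (isCompact_closedBall x (R : ℝ))
  have hPL : IsPicardLindelof (fun _ : ℝ => v) (tmin := -a) (tmax := a) ⟨0, by simp [ha.le]⟩ x R 0
      B' K :=
    { lipschitzOnWith := fun _ _ => hK
      continuousOn := fun _ _ => continuousOn_const
      norm_le := fun _ _ y _ => (hB y).trans hBB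
      mul_max_le := by simp [hR, ha.le] }
  obtain ⟨γ, h0, hγ⟩ := hPL.exists_eq_forall_mem_Icc_hasDerivWithinAt₀
  refine ⟨γ, h0, fun t ht => ?_⟩
  have h1 := (hγ t ⟨ht.1.le, ht.2.le⟩).mono Set.Ioo_subset_Icc_self
  exact h1.hasFDerivWithinAt.hasMFDerivWithinAt

open scoped RealInnerProductSpace in
/-- A `C¹` vector field tangent to the spheres around the origin has global integral curves: it may
be cut off outside the sphere that contains the initial value. -/
theorem exists_isIntegralCurve_of_inner_eq_zero {E : Type*} [NormedAddCommGroup E]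
    [InnerProductSpace ℝ E] [FiniteDimensional ℝ E] {X : E → E} (hX : ContDiff ℝ 1 X)
    (horth : ∀ x, ⟪x, X x⟫ = 0) (x : E) :
    ∃ γ : ℝ → E, γ 0 = x ∧ IsIntegralCurve γ (fun _ => X) := by
  let f : ContDiffBump (0 : E) := ⟨‖x‖ + 1, ‖x‖ + 2, by positivity, by linarith⟩
  have hv : ContDiff ℝ 1 (fun y => f y • X y) := f.contDiff.smul hX
  have hsupp : HasCompactSupport (fun y => f y • X y) := f.hasCompactSupport.smul_right
  obtain ⟨B, hB⟩ := hsupp.exists_bound_of_continuous hv.continuous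
  obtain ⟨γ, h0, hγ⟩ := exists_isIntegralCurve_of_bounded hv hB x
  have hnorm : ∀ t, ‖γ t‖ ^ 2 = ‖x‖ ^ 2 := by
    have hd : ∀ t, HasDerivAt (fun t => ‖γ t‖ ^ 2) 0 t := fun t => by
      have := (hγ t).norm_sq
      simpa [inner_smul_right, horth] using this
    intro t
    rw [← h0]
    exact is_const_of_deriv_eq_zero (fun t => (hd t).differentiableAt) (fun t => (hd t).deriv) t 0
  refine ⟨γ, h0, fun t => (hγ t).congr_deriv ?_⟩
  have h1 : ‖γ t‖ = ‖x‖ := by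
    have := hnorm t
    exact (pow_left_inj₀ (norm_nonneg _) (norm_nonneg _) two_ne_zero).1 this
  have : f (γ t) = 1 := f.one_of_mem_closedBall (by simp [f, h1])
  simp [this]

theorem constant_along_integralCurve {X : So4 → So4} {F : So4 → ℝ} (hF : Differentiable ℝ F)
    (hX : ∀ N, fderiv ℝ F N (X N) = 0) {γ : ℝ → So4}
    (hγ : IsIntegralCurveOn γ (fun _ => X) (Set.Ici 0)) {t : ℝ} (ht : 0 ≤ t) :
    F (γ t) = F (γ 0) := by
  have hd : ∀ s ∈ Set.Ici (0 : ℝ), HasDerivWithinAt (F ∘ γ) 0 (Set.Ici 0) s := fun s hs => by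
    have := (hF (γ s)).hasFDerivAt.comp_hasDerivWithinAt s (hγ s hs)
    rwa [hX] at this
  exact (convex_Ici (0 : ℝ)).is_const_of_fderivWithin_eq_zero
    (f := F ∘ γ) (fun s hs => (hd s hs).differentiableWithinAt)
    (fun s hs => by
      have := (hd s hs).hasFDerivWithinAt.fderivWithin
        ((uniqueDiffOn_Ici (0 : ℝ)) s hs)
      rw [this]; ext; simp) ht Set.self_mem_Ici

/-- Lyapunov's criterion for a conserved function with a quadratic lower bound. -/
theorem isNonlinearlyStableOn_of_conserved {X : So4 → So4} {G : So4 → ℝ} {M : So4}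
    (hG : Differentiable ℝ G) (hX : ∀ N, fderiv ℝ G N (X N) = 0) {c ε₀ : ℝ} (hc : 0 < c)
    (hε₀ : 0 < ε₀) (hmin : ∀ N, dist N M < ε₀ → c * dist N M ^ 2 ≤ G N - G M) (S : Set So4) :
    IsNonlinearlyStableOn X S M := by
  intro ε hε
  set r := min (ε / 2) (ε₀ / 2) with hr
  have hr0 : 0 < r := by positivity
  have hcont : ContinuousAt G M := (hG M).continuousAt
  obtain ⟨δ, hδ, hδG⟩ := Metric.continuousAt_iff.1 hcont (c * r ^ 2) (by positivity)
  refine ⟨min δ r, by positivity, fun γ hγ _ h0 => ?_⟩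
  have hG0 : G (γ 0) - G M < c * r ^ 2 :=
    (le_abs_self _).trans_lt (hδG (h0.trans_le (min_le_left _ _)))
  have hcγ : ContinuousOn (fun t => dist (γ t) M) (Set.Ici 0) :=
    (continuous_id.dist (continuous_const (y := M))).comp_continuousOn (f := γ)
      fun s hs => (hγ s hs).continuousWithinAt
  suffices h : ∀ t ≥ 0, dist (γ t) M < r from fun t ht =>
    (h t ht).trans_le ((min_le_left _ _).trans (by linarith))
  intro t ht
  by_contra! hcon
  have hsub : Set.Icc 0 t ⊆ Set.Ici (0 : ℝ) := fun s hs => hs.1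
  obtain ⟨s, hs, hsr⟩ := intermediate_value_Icc ht (hcγ.mono hsub)
    (show r ∈ Set.Icc _ _ from ⟨(h0.trans_le (min_le_right _ _)).le, hcon⟩)
  have hsr' : dist (γ s) M = r := hsr
  have h1 := hmin (γ s) (by rw [hsr']; exact (min_le_right _ _).trans_lt (by linarith))
  rw [constant_along_integralCurve hG hX hγ hs.1, hsr'] at h1
  linarith

/-- Chetaev's criterion: where `V` is bounded and grows at a rate proportional to `V`, an integral
curve that starts with `V > 0` cannot stay forever. -/
theorem exists_le_dist_of_chetaev {X : So4 → So4} {V : So4 → ℝ} {M : So4} {ε k B : ℝ}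
    (hV : Differentiable ℝ V) (hk : 0 < k)
    (hgrow : ∀ N, dist N M < ε → k * V N ≤ fderiv ℝ V N (X N)) (hB : ∀ N, dist N M < ε → V N ≤ B)
    {γ : ℝ → So4} (hγ : IsIntegralCurve γ (fun _ => X)) (h0 : 0 < V (γ 0)) :
    ∃ t ≥ 0, ε ≤ dist (γ t) M := by
  by_contra! hcon
  have hd : ∀ s, HasDerivAt (V ∘ γ) (fderiv ℝ V (γ s) (X (γ s))) s := fun s =>
    (hV (γ s)).hasFDerivAt.comp_hasDerivAt s (hγ s)
  -- The function `exp (-k t) V (γ t)` is nondecreasing, so `V` grows at least exponentially.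
  have hd2 : ∀ s, HasDerivAt (fun s => Real.exp (-k * s) * V (γ s))
      (Real.exp (-k * s) * (-k * 1) * V (γ s)
        + Real.exp (-k * s) * fderiv ℝ V (γ s) (X (γ s))) s := fun s =>
    (((hasDerivAt_id s).const_mul (-k)).exp).mul (hd s)
  have hmono : MonotoneOn (fun s => Real.exp (-k * s) * V (γ s)) (Set.Ici 0) := by
    refine monotoneOn_of_deriv_nonneg (convex_Ici 0)
      (fun s _ => (hd2 s).continuousAt.continuousWithinAt)
      (fun s _ => (hd2 s).differentiableAt.differentiableWithinAt) fun s hs => ?_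
    rw [interior_Ici] at hs
    rw [(hd2 s).deriv]
    have := mul_le_mul_of_nonneg_left (hgrow _ (hcon s (le_of_lt hs))) (Real.exp_pos (-k * s)).le
    linarith
  have hle : ∀ t ≥ 0, V (γ 0) * Real.exp (k * t) ≤ B := fun t ht => by
    have h1 := hmono Set.self_mem_Ici ht ht
    simp only [mul_zero, Real.exp_zero, one_mul, neg_mul, Real.exp_neg] at h1
    rw [inv_mul_eq_div, le_div_iff₀ (Real.exp_pos _)] at h1
    exact h1.trans (hB _ (hcon t ht))
  have hB0 : 0 < B := h0.trans_le (hB _ (hcon 0 le_rfl))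
  have := hle (B / V (γ 0) / k) (by positivity)
  have h2 : k * (B / V (γ 0) / k) = B / V (γ 0) := by field_simp
  rw [h2] at this
  have h3 := Real.add_one_le_exp (B / V (γ 0))
  have h4 : V (γ 0) * (B / V (γ 0) + 1) = B + V (γ 0) := by field_simp
  nlinarith

/-! ### The energy functions as quadratic forms -/

/-- The symmetric bilinear form on `so(4)` with diagonal entries `k` in the coordinates
`(x₁, x₂, x₃, y₁, y₂, y₃)` whose only other nonzero entries, all equal to `n`, couple `xᵢ` with
`yᵢ`. -/
noncomputable def pairedBilin (k : Fin 6 → ℝ) (n : ℝ) : So4 →L[ℝ] So4 →L[ℝ] ℝ :=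
  ∑ i, k i • (EuclideanSpace.proj i : So4 →L[ℝ] ℝ).smulRight (EuclideanSpace.proj i : So4 →L[ℝ] ℝ)
    + n • ∑ i : Fin 3,
      ((EuclideanSpace.proj (Fin.castAdd 3 i) : So4 →L[ℝ] ℝ).smulRight
          (EuclideanSpace.proj (Fin.natAdd 3 i) : So4 →L[ℝ] ℝ)
        + (EuclideanSpace.proj (Fin.natAdd 3 i) : So4 →L[ℝ] ℝ).smulRight
          (EuclideanSpace.proj (Fin.castAdd 3 i) : So4 →L[ℝ] ℝ))

set_option synthInstance.maxHeartbeats 200000 in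
theorem pairedBilin_apply (k : Fin 6 → ℝ) (n : ℝ) (v w : So4) :
    pairedBilin k n v w = k 0 * v 0 * w 0 + k 1 * v 1 * w 1 + k 2 * v 2 * w 2 + k 3 * v 3 * w 3
      + k 4 * v 4 * w 4 + k 5 * v 5 * w 5
      + n * (v 0 * w 3 + v 3 * w 0 + (v 1 * w 4 + v 4 * w 1) + (v 2 * w 5 + v 5 * w 2)) := by
  simp [pairedBilin, Fin.sum_univ_succ, Fin.natAdd, Fin.castAdd, Fin.castLE]
  ring

theorem hasFDerivAt_pairedBilin_self (k : Fin 6 → ℝ) (n : ℝ) (N : So4) :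
    HasFDerivAt (fun N => 1 / 2 * pairedBilin k n N N) (pairedBilin k n N) N := by
  have h := ((pairedBilin k n).hasFDerivAt (x := N)).clm_apply (hasFDerivAt_id N)
  refine (h.const_mul (1 / 2)).congr_fderiv ?_
  ext w
  simp [pairedBilin_apply]
  ring

/-- The diagonal entries of the Hessian of `μ₁ H + μ₂ I + m C₁ + n C₂`. -/
noncomputable def energyCoeff (l : Fin 4 → ℝ) (μ₁ μ₂ m : ℝ) : Fin 6 → ℝ :=
  ![μ₁ / (l 1 + l 2) + 2 * μ₂ * (l 1 ^ 2 + l 2 ^ 2) + m,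
    μ₁ / (l 0 + l 2) + 2 * μ₂ * (l 0 ^ 2 + l 2 ^ 2) + m,
    μ₁ / (l 0 + l 1) + 2 * μ₂ * (l 0 ^ 2 + l 1 ^ 2) + m,
    μ₁ / (l 0 + l 3) + 2 * μ₂ * (l 0 ^ 2 + l 3 ^ 2) + m,
    μ₁ / (l 1 + l 3) + 2 * μ₂ * (l 1 ^ 2 + l 3 ^ 2) + m,
    μ₁ / (l 2 + l 3) + 2 * μ₂ * (l 2 ^ 2 + l 3 ^ 2) + m]

theorem energyFunction_eq (l : Fin 4 → ℝ) (μ₁ μ₂ m n : ℝ) :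
    energyFunction l μ₁ μ₂ m n
      = fun N => 1 / 2 * pairedBilin (energyCoeff l μ₁ μ₂ m) n N N := by
  ext N
  simp [pairedBilin_apply, energyCoeff, energyFunction, hamiltonian, mishchenko, casimir₁,
    casimir₂]
  ring

theorem hasFDerivAt_energyFunction (l : Fin 4 → ℝ) (μ₁ μ₂ m n : ℝ) (N : So4) :
    HasFDerivAt (energyFunction l μ₁ μ₂ m n) (pairedBilin (energyCoeff l μ₁ μ₂ m) n N) N := by
  rw [energyFunction_eq]
  exact hasFDerivAt_pairedBilin_self _ _ _

theorem fderiv_energyFunction (l : Fin 4 → ℝ) (μ₁ μ₂ m n : ℝ) :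
    fderiv ℝ (energyFunction l μ₁ μ₂ m n) = pairedBilin (energyCoeff l μ₁ μ₂ m) n :=
  funext fun N => (hasFDerivAt_energyFunction l μ₁ μ₂ m n N).fderiv

theorem fderiv_fderiv_energyFunction (l : Fin 4 → ℝ) (μ₁ μ₂ m n : ℝ) (N : So4) :
    fderiv ℝ (fderiv ℝ (energyFunction l μ₁ μ₂ m n)) N
      = pairedBilin (energyCoeff l μ₁ μ₂ m) n := by
  rw [fderiv_energyFunction]
  exact (pairedBilin _ n).fderiv

theorem energyFunction_casimir₁ (l : Fin 4 → ℝ) : energyFunction l 0 0 1 0 = casimir₁ := by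
  ext N; simp [energyFunction]

theorem energyFunction_casimir₂ (l : Fin 4 → ℝ) : energyFunction l 0 0 0 1 = casimir₂ := by
  ext N; simp [energyFunction]

/-- `H`, `I`, `C₁` and `C₂` are constants of motion. -/
theorem fderiv_energyFunction_rigidBodyField {l : Fin 4 → ℝ}
    (hpos : ∀ i j, i ≠ j → 0 < l i + l j) (μ₁ μ₂ m n : ℝ) (N : So4) :
    fderiv ℝ (energyFunction l μ₁ μ₂ m n) N (rigidBodyField l N) = 0 := by
  have h01 := (hpos 0 1 (by decide)).ne'
  have h02 := (hpos 0 2 (by decide)).ne'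
  have h03 := (hpos 0 3 (by decide)).ne'
  have h12 := (hpos 1 2 (by decide)).ne'
  have h13 := (hpos 1 3 (by decide)).ne'
  have h23 := (hpos 2 3 (by decide)).ne'
  rw [fderiv_energyFunction, pairedBilin_apply]
  simp only [energyCoeff, rigidBodyField, div_eq_mul_inv, one_mul]
  have e01 := mul_inv_cancel₀ h01
  have e02 := mul_inv_cancel₀ h02
  have e03 := mul_inv_cancel₀ h03
  have e12 := mul_inv_cancel₀ h12
  have e13 := mul_inv_cancel₀ h13
  have e23 := mul_inv_cancel₀ h23
  generalize (l 0 + l 1)⁻¹ = w01 at *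
  generalize (l 0 + l 2)⁻¹ = w02 at *
  generalize (l 0 + l 3)⁻¹ = w03 at *
  generalize (l 1 + l 2)⁻¹ = w12 at *
  generalize (l 1 + l 3)⁻¹ = w13 at *
  generalize (l 2 + l 3)⁻¹ = w23 at *
  simp
  linear_combination (2 * μ₂) * ((N 0 * N 1 * N 2 - N 2 * N 3 * N 4) * (l 1 - l 0) * e01
    - (N 0 * N 1 * N 2 - N 0 * N 4 * N 5) * (l 1 - l 2) * e12
    + (N 0 * N 1 * N 2 - N 1 * N 3 * N 5) * (l 0 - l 2) * e02
    - (N 0 * N 4 * N 5 - N 2 * N 3 * N 4) * (l 1 - l 3) * e13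
    + (N 0 * N 4 * N 5 - N 1 * N 3 * N 5) * (l 2 - l 3) * e23
    + (N 1 * N 3 * N 5 - N 2 * N 3 * N 4) * (l 0 - l 3) * e03)

theorem mem_casimirKernel {s t : ℝ} (hst : s ^ 2 ≠ t ^ 2) (w : So4) :
    w ∈ casimirKernel (equilibrium₁ s t) ↔ w 0 = 0 ∧ w 3 = 0 := by
  rw [casimirKernel, ← energyFunction_casimir₁ 0, ← energyFunction_casimir₂ 0]
  simp only [fderiv_energyFunction, Submodule.mem_inf, LinearMap.mem_ker]
  simp [pairedBilin_apply, energyCoeff, equilibrium₁]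
  constructor
  · rintro ⟨h1, h2⟩
    have h3 : s ^ 2 - t ^ 2 ≠ 0 := sub_ne_zero.2 hst
    constructor
    · refine (mul_eq_zero.1 (?_ : (s ^ 2 - t ^ 2) * w 0 = 0)).resolve_left h3
      linear_combination s * h1 - t * h2
    · refine (mul_eq_zero.1 (?_ : (s ^ 2 - t ^ 2) * w 3 = 0)).resolve_left h3
      linear_combination s * h2 - t * h1
  · rintro ⟨h1, h2⟩
    simp [h1, h2]

theorem fderiv_energyFunction_equilibrium₁_eq_zero_iff (l : Fin 4 → ℝ) (μ₁ μ₂ m n s t : ℝ) :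
    fderiv ℝ (energyFunction l μ₁ μ₂ m n) (equilibrium₁ s t) = 0 ↔
      energyCoeff l μ₁ μ₂ m 0 * s + n * t = 0 ∧ energyCoeff l μ₁ μ₂ m 3 * t + n * s = 0 := by
  rw [fderiv_energyFunction]
  constructor
  · intro h
    have h0 := DFunLike.congr_fun h (EuclideanSpace.single 0 1)
    have h3 := DFunLike.congr_fun h (EuclideanSpace.single 3 1)
    simp [pairedBilin_apply, equilibrium₁] at h0 h3
    exact ⟨h0, h3⟩
  · rintro ⟨h0, h3⟩
    ext w
    simp [pairedBilin_apply, equilibrium₁]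
    linear_combination w 0 * h0 + w 3 * h3

theorem rigidBodyField_equilibrium₁ (l : Fin 4 → ℝ) (s t : ℝ) :
    rigidBodyField l (equilibrium₁ s t) = 0 := by
  ext i
  fin_cases i <;> simp [rigidBodyField, equilibrium₁]

theorem contDiff_rigidBodyField (l : Fin 4 → ℝ) : ContDiff ℝ 1 (rigidBodyField l) := by
  rw [contDiff_euclidean]
  intro i
  fin_cases i <;> simp [rigidBodyField] <;> fun_prop

/-! ### Definiteness of the Hessian and nonlinear stability -/

theorem exists_mul_le_sq_add_sq {a b c d : ℝ} (h : a * d - b * c ≠ 0) :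
    ∃ k > 0, ∀ x y : ℝ, k * (x ^ 2 + y ^ 2) ≤ (a * x + b * y) ^ 2 + (c * x + d * y) ^ 2 := by
  have hd : 0 < (a * d - b * c) ^ 2 := by positivity
  have hn : 0 < a ^ 2 + b ^ 2 + c ^ 2 + d ^ 2 := by
    by_contra! hle
    have ha : a = 0 := by nlinarith [sq_nonneg a, sq_nonneg b, sq_nonneg c, sq_nonneg d]
    have hb : b = 0 := by nlinarith [sq_nonneg a, sq_nonneg b, sq_nonneg c, sq_nonneg d]
    exact h (by simp [ha, hb])
  refine ⟨(a * d - b * c) ^ 2 / (a ^ 2 + b ^ 2 + c ^ 2 + d ^ 2), by positivity, fun x y => ?_⟩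
  rw [div_mul_eq_mul_div, div_le_iff₀ hn]
  -- Cauchy-Schwarz for the product of the adjugate matrix with the image of `(x, y)`.
  have e : ((a * x + b * y) ^ 2 + (c * x + d * y) ^ 2) * (a ^ 2 + b ^ 2 + c ^ 2 + d ^ 2)
      - (a * d - b * c) ^ 2 * (x ^ 2 + y ^ 2)
      = (b * (a * x + b * y) + d * (c * x + d * y)) ^ 2
        + (a * (a * x + b * y) + c * (c * x + d * y)) ^ 2 := by ring
  nlinarith [sq_nonneg (b * (a * x + b * y) + d * (c * x + d * y)),
    sq_nonneg (a * (a * x + b * y) + c * (c * x + d * y))]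

theorem exists_mul_le_quadratic {a b n : ℝ} (ha : 0 < a) (hdet : n ^ 2 < a * b) :
    ∃ k > 0, ∀ x y : ℝ, k * (x ^ 2 + y ^ 2) ≤ a * x ^ 2 + b * y ^ 2 + 2 * n * x * y := by
  have hb : 0 < b := pos_of_mul_pos_right ((sq_nonneg n).trans_lt hdet) ha.le
  refine ⟨(a * b - n ^ 2) / (a + b), div_pos (by linarith) (by linarith), fun x y => ?_⟩
  rw [div_mul_eq_mul_div, div_le_iff₀ (by linarith)]
  nlinarith [sq_nonneg (a * x + n * y), sq_nonneg (n * x + b * y)]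

theorem so4_dist_sq (N M : So4) :
    dist N M ^ 2 = (N 0 - M 0) ^ 2 + (N 1 - M 1) ^ 2 + (N 2 - M 2) ^ 2 + (N 3 - M 3) ^ 2
      + (N 4 - M 4) ^ 2 + (N 5 - M 5) ^ 2 := by
  rw [dist_eq_norm, EuclideanSpace.norm_sq_eq]
  simp [Fin.sum_univ_succ]
  ring

theorem transverse_lower_bound {k : Fin 6 → ℝ} {n : ℝ} (h1 : 0 < k 1) (h2 : 0 < k 2)
    (hd1 : n ^ 2 < k 1 * k 4) (hd2 : n ^ 2 < k 2 * k 5) :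
    ∃ c > 0, ∀ v : So4, c * (v 1 ^ 2 + v 2 ^ 2 + v 4 ^ 2 + v 5 ^ 2) ≤
      k 1 * v 1 ^ 2 + k 4 * v 4 ^ 2 + 2 * n * v 1 * v 4
        + (k 2 * v 2 ^ 2 + k 5 * v 5 ^ 2 + 2 * n * v 2 * v 5) := by
  obtain ⟨c, hc, h⟩ := exists_mul_le_quadratic h1 hd1
  obtain ⟨c', hc', h'⟩ := exists_mul_le_quadratic h2 hd2
  refine ⟨min c c', by positivity, fun v => ?_⟩
  nlinarith [h (v 1) (v 4), h' (v 2) (v 5),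
    mul_le_mul_of_nonneg_right (min_le_left c c') (add_nonneg (sq_nonneg (v 1)) (sq_nonneg (v 4))),
    mul_le_mul_of_nonneg_right (min_le_right c c') (add_nonneg (sq_nonneg (v 2)) (sq_nonneg (v 5)))]

/-- The Hessian on `W` is the sum of a form in `x₂, y₂` and one in `x₃, y₃`. -/
theorem hessianPosDefOn_of_blocks {l : Fin 4 → ℝ} {μ₁ μ₂ m n s t : ℝ} (hst : s ^ 2 ≠ t ^ 2)
    (h1 : 0 < energyCoeff l μ₁ μ₂ m 1) (h2 : 0 < energyCoeff l μ₁ μ₂ m 2)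
    (hd1 : n ^ 2 < energyCoeff l μ₁ μ₂ m 1 * energyCoeff l μ₁ μ₂ m 4)
    (hd2 : n ^ 2 < energyCoeff l μ₁ μ₂ m 2 * energyCoeff l μ₁ μ₂ m 5) :
    HessianPosDefOn (energyFunction l μ₁ μ₂ m n) (equilibrium₁ s t)
      (casimirKernel (equilibrium₁ s t)) := by
  intro w hw hw0
  obtain ⟨w0, w3⟩ := (mem_casimirKernel hst w).1 hw
  obtain ⟨c, hc, h⟩ := transverse_lower_bound h1 h2 hd1 hd2
  rw [fderiv_fderiv_energyFunction, pairedBilin_apply]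
  have hpos : 0 < w 1 ^ 2 + w 2 ^ 2 + w 4 ^ 2 + w 5 ^ 2 := by
    by_contra! hle
    apply hw0
    have e1 : w 1 = 0 := by
      nlinarith [sq_nonneg (w 1), sq_nonneg (w 2), sq_nonneg (w 4), sq_nonneg (w 5)]
    have e2 : w 2 = 0 := by
      nlinarith [sq_nonneg (w 1), sq_nonneg (w 2), sq_nonneg (w 4), sq_nonneg (w 5)]
    have e4 : w 4 = 0 := by
      nlinarith [sq_nonneg (w 1), sq_nonneg (w 2), sq_nonneg (w 4), sq_nonneg (w 5)]
    have e5 : w 5 = 0 := by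
      nlinarith [sq_nonneg (w 1), sq_nonneg (w 2), sq_nonneg (w 4), sq_nonneg (w 5)]
    ext i
    fin_cases i <;> simp [*]
  have := mul_pos hc hpos
  have := h w
  simp only [w0, w3]
  linarith

/-- The energy function with a penalty, weighted by `K`, for leaving the orbit of `M`. -/
noncomputable def penalizedEnergy (l : Fin 4 → ℝ) (μ₁ μ₂ m n K : ℝ) (M N : So4) : ℝ :=
  energyFunction l μ₁ μ₂ m n N
    + K * ((casimir₁ N - casimir₁ M) ^ 2 + (casimir₂ N - casimir₂ M) ^ 2)

theorem hasFDerivAt_penalizedEnergy (l : Fin 4 → ℝ) (μ₁ μ₂ m n K : ℝ) (M N : So4) :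
    HasFDerivAt (penalizedEnergy l μ₁ μ₂ m n K M)
      (fderiv ℝ (energyFunction l μ₁ μ₂ m n) N
        + K • ((2 * (casimir₁ N - casimir₁ M)) • fderiv ℝ casimir₁ N
          + (2 * (casimir₂ N - casimir₂ M)) • fderiv ℝ casimir₂ N)) N := by
  have h := (hasFDerivAt_energyFunction l μ₁ μ₂ m n N).differentiableAt.hasFDerivAt
  have h1 := (hasFDerivAt_energyFunction l 0 0 1 0 N).differentiableAt.hasFDerivAt
  have h2 := (hasFDerivAt_energyFunction l 0 0 0 1 N).differentiableAt.hasFDerivAt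
  rw [energyFunction_casimir₁] at h1
  rw [energyFunction_casimir₂] at h2
  refine (h.add ((((h1.sub_const (casimir₁ M)).pow 2).add
    ((h2.sub_const (casimir₂ M)).pow 2)).const_mul K)).congr_fderiv ?_
  ext w
  simp

/-- The penalty `K` dominates the possibly negative form `k₀ x² + k₃ y² + 2 n x y` in the
directions transverse to the level sets of the Casimir functions. Here `ρ` is the squared distance
to the critical point, `τ` the squared length of the part along the level sets, `T` the value of the
Hessian on this part, and `e` the quadratic part of the second Casimir function. -/
theorem penalty_estimate {k₀ k₃ n s t x y e T τ ρ A c β K : ℝ} (hK : 0 < K)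
    (hρ : ρ = x ^ 2 + y ^ 2 + τ) (hτ : 0 ≤ τ) (hA : A = |k₀| + |k₃| + |n|) (hKβ : K * β = A + c)
    (hT : c * τ ≤ T) (hβ : β * (x ^ 2 + y ^ 2) ≤ (s * x + t * y) ^ 2 + (t * x + s * y) ^ 2)
    (he : |e| ≤ 1 / 2 * ρ) (hsmall : K * ρ ≤ c / 2) :
    c / 4 * ρ ≤ 1 / 2 * (k₀ * x ^ 2 + k₃ * y ^ 2 + 2 * n * x * y + T)
      + K * ((s * x + t * y + 1 / 2 * ρ) ^ 2 + (t * x + s * y + e) ^ 2) := by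
  have hρ0 : 0 ≤ ρ := by rw [hρ]; positivity
  have hlong : -A * (x ^ 2 + y ^ 2) ≤ k₀ * x ^ 2 + k₃ * y ^ 2 + 2 * n * x * y := by
    have e1 : -|k₀| * x ^ 2 ≤ k₀ * x ^ 2 :=
      mul_le_mul_of_nonneg_right (neg_abs_le _) (sq_nonneg _)
    have e2 : -|k₃| * y ^ 2 ≤ k₃ * y ^ 2 :=
      mul_le_mul_of_nonneg_right (neg_abs_le _) (sq_nonneg _)
    have e3 : -|n| * (x ^ 2 + y ^ 2) ≤ 2 * n * x * y := by
      have h1 := le_abs_self n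
      have h2 := neg_abs_le n
      linarith [mul_nonneg (by linarith : 0 ≤ |n| - n) (sq_nonneg (x - y)),
        mul_nonneg (by linarith : 0 ≤ |n| + n) (sq_nonneg (x + y))]
    have e4 := mul_nonneg (abs_nonneg k₀) (sq_nonneg y)
    have e5 := mul_nonneg (abs_nonneg k₃) (sq_nonneg x)
    rw [hA]
    linarith
  have hpen : ∀ p q : ℝ, |q| ≤ 1 / 2 * ρ → 1 / 2 * p ^ 2 - 1 / 4 * ρ ^ 2 ≤ (p + q) ^ 2 := by
    intro p q hq
    have : q ^ 2 ≤ (1 / 2 * ρ) ^ 2 := sq_le_sq' (abs_le.1 hq).1 (abs_le.1 hq).2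
    linarith [sq_nonneg (p + 2 * q)]
  have hp1 := hpen (s * x + t * y) (1 / 2 * ρ) (by rw [abs_of_nonneg (by positivity)])
  have hp2 := hpen (t * x + s * y) e he
  have hpK := mul_le_mul_of_nonneg_left (add_le_add hp1 hp2) hK.le
  have hβK := mul_le_mul_of_nonneg_left hβ hK.le
  have hρK := mul_le_mul_of_nonneg_right hsmall hρ0
  have hKβ' : K * (β * (x ^ 2 + y ^ 2)) = (A + c) * (x ^ 2 + y ^ 2) := by rw [← hKβ]; ring
  have hc' : c * ρ = c * (x ^ 2 + y ^ 2) + c * τ := by rw [hρ]; ring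
  linarith

/-- A critical point with positive definite Hessian on `W` is a nondegenerate local minimum of the
penalized energy on the whole of `so(4)`, if the penalty is large. -/
theorem penalizedEnergy_growth {l : Fin 4 → ℝ} {μ₁ μ₂ m n s t : ℝ} (hst : s ^ 2 ≠ t ^ 2)
    (hcrit : fderiv ℝ (energyFunction l μ₁ μ₂ m n) (equilibrium₁ s t) = 0)
    (h1 : 0 < energyCoeff l μ₁ μ₂ m 1) (h2 : 0 < energyCoeff l μ₁ μ₂ m 2)
    (hd1 : n ^ 2 < energyCoeff l μ₁ μ₂ m 1 * energyCoeff l μ₁ μ₂ m 4)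
    (hd2 : n ^ 2 < energyCoeff l μ₁ μ₂ m 2 * energyCoeff l μ₁ μ₂ m 5) :
    ∃ K, ∃ c > 0, ∃ ε > 0, ∀ N, dist N (equilibrium₁ s t) < ε →
      c * dist N (equilibrium₁ s t) ^ 2 ≤
        penalizedEnergy l μ₁ μ₂ m n K (equilibrium₁ s t) N
          - penalizedEnergy l μ₁ μ₂ m n K (equilibrium₁ s t) (equilibrium₁ s t) := by
  obtain ⟨c, hc, hcv⟩ := transverse_lower_bound h1 h2 hd1 hd2
  obtain ⟨β, hβ, hβv⟩ := exists_mul_le_sq_add_sq (a := s) (b := t) (c := t) (d := s)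
    (by intro h; apply hst; linarith)
  rw [fderiv_energyFunction_equilibrium₁_eq_zero_iff] at hcrit
  obtain ⟨hs, ht⟩ := hcrit
  simp only [penalizedEnergy, energyFunction_eq, pairedBilin_apply]
  set k := energyCoeff l μ₁ μ₂ m with hk
  set A := |k 0| + |k 3| + |n| with hA
  have hA0 : 0 ≤ A := by positivity
  set K := (A + c) / β with hK
  have hKβ : K * β = A + c := by rw [hK]; field_simp
  have hK0 : 0 < K := by positivity
  refine ⟨K, c / 4, by positivity, √(c / (2 * K)), by positivity, fun N hN => ?_⟩
  have hN2 : dist N (equilibrium₁ s t) ^ 2 ≤ c / (2 * K) := by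
    have := (Real.lt_sqrt dist_nonneg).1 hN
    exact this.le
  rw [le_div_iff₀ (by positivity)] at hN2
  have hcv := hcv (N - equilibrium₁ s t)
  rw [so4_dist_sq] at *
  simp [equilibrium₁, casimir₁, casimir₂] at hcv hN2 ⊢
  have hβv := hβv (N 0 - s) (N 3 - t)
  have key := penalty_estimate (k₀ := k 0) (k₃ := k 3) (n := n)
    (e := (N 0 - s) * (N 3 - t) + N 1 * N 4 + N 2 * N 5) hK0
    (ρ := (N 0 - s) ^ 2 + N 1 ^ 2 + N 2 ^ 2 + (N 3 - t) ^ 2 + N 4 ^ 2 + N 5 ^ 2)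
    (τ := N 1 ^ 2 + N 2 ^ 2 + N 4 ^ 2 + N 5 ^ 2) (by ring) (by positivity) hA hKβ hcv hβv
    (by
      rw [abs_le]; constructor
      · linarith [sq_nonneg (N 0 - s + (N 3 - t)), sq_nonneg (N 1 + N 4), sq_nonneg (N 2 + N 5)]
      · linarith [sq_nonneg (N 0 - s - (N 3 - t)), sq_nonneg (N 1 - N 4), sq_nonneg (N 2 - N 5)])
    (by linarith)
  refine key.trans (le_of_eq ?_)
  linear_combination -(N 0 - s) * hs - (N 3 - t) * ht

/-! ### The bifurcation quadratic and the entries of the Hessian at an equilibrium -/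

theorem sq_strictAnti {l : Fin 4 → ℝ} (hl : StrictAnti l)
    (hpos : ∀ i j, i ≠ j → 0 < l i + l j) : StrictAnti fun i => l i ^ 2 := by
  intro i j hij
  have h1 := hl hij
  have h2 := hpos i j hij.ne
  have : 0 < (l i - l j) * (l i + l j) := mul_pos (by linarith) h2
  show l j ^ 2 < l i ^ 2
  linarith

/-- The lower root `α₁` of the bifurcation quadratic, in the form
`(√((λ₁² - λ₃²)(λ₂² - λ₄²)) - √((λ₁² - λ₂²)(λ₃² - λ₄²)))² / (λ₁² - λ₄²)²`. -/
noncomputable def bifurcationRoot₁ (l : Fin 4 → ℝ) : ℝ :=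
  ((√((l 0 ^ 2 - l 2 ^ 2) * (l 1 ^ 2 - l 3 ^ 2)) - √((l 0 ^ 2 - l 1 ^ 2) * (l 2 ^ 2 - l 3 ^ 2)))
    / (l 0 ^ 2 - l 3 ^ 2)) ^ 2

/-- The upper root `α₂` of the bifurcation quadratic, in the form
`(√((λ₁² - λ₃²)(λ₂² - λ₄²)) + √((λ₁² - λ₂²)(λ₃² - λ₄²)))² / (λ₁² - λ₄²)²`. -/
noncomputable def bifurcationRoot₂ (l : Fin 4 → ℝ) : ℝ :=
  ((√((l 0 ^ 2 - l 2 ^ 2) * (l 1 ^ 2 - l 3 ^ 2)) + √((l 0 ^ 2 - l 1 ^ 2) * (l 2 ^ 2 - l 3 ^ 2)))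
    / (l 0 ^ 2 - l 3 ^ 2)) ^ 2

section
variable {l : Fin 4 → ℝ} (hu : StrictAnti fun i => l i ^ 2)
include hu

theorem bifurcationQuadratic_eq (t : ℝ) :
    bifurcationQuadratic l t
      = (l 0 ^ 2 - l 3 ^ 2) ^ 2 * ((t - bifurcationRoot₁ l) * (t - bifurcationRoot₂ l)) := by
  have h01 : l 1 ^ 2 < l 0 ^ 2 := hu (show (0 : Fin 4) < 1 by decide)
  have h12 : l 2 ^ 2 < l 1 ^ 2 := hu (show (1 : Fin 4) < 2 by decide)
  have h23 : l 3 ^ 2 < l 2 ^ 2 := hu (show (2 : Fin 4) < 3 by decide)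
  have hq := Real.sq_sqrt (mul_nonneg (by linarith : 0 ≤ l 0 ^ 2 - l 2 ^ 2)
    (by linarith : 0 ≤ l 1 ^ 2 - l 3 ^ 2))
  have hp := Real.sq_sqrt (mul_nonneg (by linarith : 0 ≤ l 0 ^ 2 - l 1 ^ 2)
    (by linarith : 0 ≤ l 2 ^ 2 - l 3 ^ 2))
  rw [bifurcationRoot₁, bifurcationRoot₂, bifurcationQuadratic]
  generalize √((l 0 ^ 2 - l 2 ^ 2) * (l 1 ^ 2 - l 3 ^ 2)) = q at *
  generalize √((l 0 ^ 2 - l 1 ^ 2) * (l 2 ^ 2 - l 3 ^ 2)) = p at *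
  have hU : l 0 ^ 2 - l 3 ^ 2 ≠ 0 := by linarith
  have hsum : (l 0 ^ 2 - l 3 ^ 2) ^ 2 * (((q - p) / (l 0 ^ 2 - l 3 ^ 2)) ^ 2
      + ((q + p) / (l 0 ^ 2 - l 3 ^ 2)) ^ 2) = 2 * (q ^ 2 + p ^ 2) := by
    field_simp; ring
  have hprod : (l 0 ^ 2 - l 3 ^ 2) ^ 2 * (((q - p) / (l 0 ^ 2 - l 3 ^ 2)) ^ 2
      * ((q + p) / (l 0 ^ 2 - l 3 ^ 2)) ^ 2) = ((q ^ 2 - p ^ 2) / (l 0 ^ 2 - l 3 ^ 2)) ^ 2 := by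
    field_simp; ring
  have hdiv : (q ^ 2 - p ^ 2) / (l 0 ^ 2 - l 3 ^ 2) = l 1 ^ 2 - l 2 ^ 2 := by
    rw [hq, hp]; field_simp; ring
  rw [hdiv] at hprod
  rw [hq, hp] at hsum
  linear_combination t * hsum - hprod

theorem bifurcationRoot₁_lt_bifurcationRoot₂ : bifurcationRoot₁ l < bifurcationRoot₂ l := by
  have h01 : l 1 ^ 2 < l 0 ^ 2 := hu (show (0 : Fin 4) < 1 by decide)
  have h12 : l 2 ^ 2 < l 1 ^ 2 := hu (show (1 : Fin 4) < 2 by decide)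
  have h23 : l 3 ^ 2 < l 2 ^ 2 := hu (show (2 : Fin 4) < 3 by decide)
  have hq := Real.sqrt_pos.2 (mul_pos (by linarith : 0 < l 0 ^ 2 - l 2 ^ 2)
    (by linarith : 0 < l 1 ^ 2 - l 3 ^ 2))
  have hp := Real.sqrt_pos.2 (mul_pos (by linarith : 0 < l 0 ^ 2 - l 1 ^ 2)
    (by linarith : 0 < l 2 ^ 2 - l 3 ^ 2))
  have hU : 0 < l 0 ^ 2 - l 3 ^ 2 := by linarith
  rw [bifurcationRoot₁, bifurcationRoot₂, div_pow, div_pow]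
  gcongr ?_ / _
  nlinarith [mul_pos hq hp]

theorem bifurcationQuadratic_eq_zero_iff (t : ℝ) :
    bifurcationQuadratic l t = 0 ↔ t = bifurcationRoot₁ l ∨ t = bifurcationRoot₂ l := by
  have h03 : l 3 ^ 2 < l 0 ^ 2 := hu (show (0 : Fin 4) < 3 by decide)
  have hU : (l 0 ^ 2 - l 3 ^ 2) ^ 2 ≠ 0 := pow_ne_zero _ (by linarith)
  rw [bifurcationQuadratic_eq hu, mul_eq_zero, mul_eq_zero, sub_eq_zero, sub_eq_zero]
  simp [hU]

theorem bifurcationQuadratic_pos {t : ℝ} (ht : bifurcationRoot₂ l < t) :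
    0 < bifurcationQuadratic l t := by
  have h03 : l 3 ^ 2 < l 0 ^ 2 := hu (show (0 : Fin 4) < 3 by decide)
  have h := bifurcationRoot₁_lt_bifurcationRoot₂ hu
  rw [bifurcationQuadratic_eq hu]
  exact mul_pos (pow_pos (by linarith) 2) (mul_pos (by linarith) (by linarith))

end

/-- The bifurcation quadratic is the discriminant of the pencil
`(w - λ₂²)(w - λ₃²) - r (w - λ₁²)(w - λ₄²)`. -/
theorem bifurcationQuadratic_eq_discrim (l : Fin 4 → ℝ) (r w : ℝ) :
    4 * (1 - r) * ((w - l 1 ^ 2) * (w - l 2 ^ 2) - r * ((w - l 0 ^ 2) * (w - l 3 ^ 2)))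
      = (2 * (1 - r) * w - (l 1 ^ 2 + l 2 ^ 2 - r * (l 0 ^ 2 + l 3 ^ 2))) ^ 2
        - bifurcationQuadratic l r := by
  rw [bifurcationQuadratic]
  ring

theorem exists_roots_of_discrim_pos {A B C : ℝ} (hA : 0 < A) (hd : 0 < B ^ 2 - 4 * A * C) :
    ∃ p₃ p₄, p₃ < p₄ ∧ ∀ p, A * p ^ 2 + B * p + C = A * ((p - p₃) * (p - p₄)) := by
  have hs := Real.sqrt_pos.2 hd
  have hsq := Real.sq_sqrt hd.le
  refine ⟨(-B - √(B ^ 2 - 4 * A * C)) / (2 * A), (-B + √(B ^ 2 - 4 * A * C)) / (2 * A), ?_, ?_⟩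
  · gcongr
    linarith
  · intro p
    generalize √(B ^ 2 - 4 * A * C) = S at *
    field_simp
    linear_combination hsq

/-- The third divided difference, at the nodes `λ₁², λ₂², λ₃², λ₄²`, of a function that takes `λᵢ²`
to `λᵢ`. -/
noncomputable def rootDividedDiff (l : Fin 4 → ℝ) : ℝ :=
  (l 0 + l 1 + l 2 + l 3)
    / ((l 0 + l 1) * (l 0 + l 2) * (l 0 + l 3) * (l 1 + l 2) * (l 1 + l 3) * (l 2 + l 3))

/-- The second divided difference, at the three nodes other than `l i ^ 2`, of a function that takes
each `l j ^ 2` to `μ₁ * l j + 2 * μ₂ * l j ^ 4`. It is an affine function of the omitted node, and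
this is the form used for the definition; for the symmetric form see `energyDividedDiff_eq`. The
first divided differences of the same function are the entries of `energyCoeff l μ₁ μ₂ 0`. -/
noncomputable def energyDividedDiff (l : Fin 4 → ℝ) (μ₁ μ₂ : ℝ) (i : Fin 4) : ℝ :=
  2 * μ₂ - μ₁ / ((l 0 + l 2) * (l 0 + l 3) * (l 2 + l 3))
    + μ₁ * rootDividedDiff l * (l 1 ^ 2 - l i ^ 2)

section
variable {l : Fin 4 → ℝ} {μ₁ μ₂ m n s t : ℝ} (hpos : ∀ i j, i ≠ j → 0 < l i + l j)
include hpos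

theorem energyDividedDiff_eq :
    energyDividedDiff l μ₁ μ₂ 0 = 2 * μ₂ - μ₁ / ((l 1 + l 2) * (l 1 + l 3) * (l 2 + l 3)) ∧
    energyDividedDiff l μ₁ μ₂ 1 = 2 * μ₂ - μ₁ / ((l 0 + l 2) * (l 0 + l 3) * (l 2 + l 3)) ∧
    energyDividedDiff l μ₁ μ₂ 2 = 2 * μ₂ - μ₁ / ((l 0 + l 1) * (l 0 + l 3) * (l 1 + l 3)) ∧
    energyDividedDiff l μ₁ μ₂ 3 = 2 * μ₂ - μ₁ / ((l 0 + l 1) * (l 0 + l 2) * (l 1 + l 2)) := by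
  have h01 := (hpos 0 1 (by decide)).ne'
  have h02 := (hpos 0 2 (by decide)).ne'
  have h03 := (hpos 0 3 (by decide)).ne'
  have h12 := (hpos 1 2 (by decide)).ne'
  have h13 := (hpos 1 3 (by decide)).ne'
  have h23 := (hpos 2 3 (by decide)).ne'
  refine ⟨?_, ?_, ?_, ?_⟩ <;> rw [energyDividedDiff, rootDividedDiff] <;> field_simp <;> ring

/-- The entries of the Hessian at a critical point `M¹_{s,t}`, where `m` and `n` are determined by
`s` and `t`. -/
theorem energyCoeff_mul (hs : energyCoeff l μ₁ μ₂ m 0 * s + n * t = 0)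
    (ht : energyCoeff l μ₁ μ₂ m 3 * t + n * s = 0) :
    (t ^ 2 - s ^ 2) * energyCoeff l μ₁ μ₂ m 1
        = t ^ 2 * (l 2 ^ 2 - l 3 ^ 2) * energyDividedDiff l μ₁ μ₂ 1
          - s ^ 2 * (l 0 ^ 2 - l 1 ^ 2) * energyDividedDiff l μ₁ μ₂ 3 ∧
    (t ^ 2 - s ^ 2) * energyCoeff l μ₁ μ₂ m 4
        = -(t ^ 2 * (l 0 ^ 2 - l 1 ^ 2) * energyDividedDiff l μ₁ μ₂ 2)
          + s ^ 2 * (l 2 ^ 2 - l 3 ^ 2) * energyDividedDiff l μ₁ μ₂ 0 ∧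
    (t ^ 2 - s ^ 2) * energyCoeff l μ₁ μ₂ m 2
        = t ^ 2 * (l 1 ^ 2 - l 3 ^ 2) * energyDividedDiff l μ₁ μ₂ 2
          - s ^ 2 * (l 0 ^ 2 - l 2 ^ 2) * energyDividedDiff l μ₁ μ₂ 3 ∧
    (t ^ 2 - s ^ 2) * energyCoeff l μ₁ μ₂ m 5
        = -(t ^ 2 * (l 0 ^ 2 - l 2 ^ 2) * energyDividedDiff l μ₁ μ₂ 1)
          + s ^ 2 * (l 1 ^ 2 - l 3 ^ 2) * energyDividedDiff l μ₁ μ₂ 0 ∧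
    (t ^ 2 - s ^ 2) * n = s * t * ((l 0 ^ 2 - l 1 ^ 2) * energyDividedDiff l μ₁ μ₂ 3
          - (l 2 ^ 2 - l 3 ^ 2) * energyDividedDiff l μ₁ μ₂ 1) := by
  have h01 := (hpos 0 1 (by decide)).ne'
  have h02 := (hpos 0 2 (by decide)).ne'
  have h03 := (hpos 0 3 (by decide)).ne'
  have h12 := (hpos 1 2 (by decide)).ne'
  have h13 := (hpos 1 3 (by decide)).ne'
  have h23 := (hpos 2 3 (by decide)).ne'
  obtain ⟨f0, f1, f2, f3⟩ := energyDividedDiff_eq (μ₁ := μ₁) (μ₂ := μ₂) hpos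
  rw [f0, f1, f2, f3]
  simp [energyCoeff] at hs ht ⊢
  have hm : (t ^ 2 - s ^ 2) * m
      = s ^ 2 * (μ₁ / (l 1 + l 2) + 2 * μ₂ * (l 1 ^ 2 + l 2 ^ 2))
        - t ^ 2 * (μ₁ / (l 0 + l 3) + 2 * μ₂ * (l 0 ^ 2 + l 3 ^ 2)) := by
    linear_combination t * ht - s * hs
  refine ⟨?_, ?_, ?_, ?_, ?_⟩
  · rw [mul_add, hm]; field_simp; ring
  · rw [mul_add, hm]; field_simp; ring
  · rw [mul_add, hm]; field_simp; ring
  · rw [mul_add, hm]; field_simp; ring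
  · have hn : (t ^ 2 - s ^ 2) * n = s * t * (μ₁ / (l 0 + l 3) + 2 * μ₂ * (l 0 ^ 2 + l 3 ^ 2)
        - (μ₁ / (l 1 + l 2) + 2 * μ₂ * (l 1 ^ 2 + l 2 ^ 2))) := by
      linear_combination t * hs - s * ht
    rw [hn]; field_simp; ring

/-- The determinants of the two transverse blocks of the Hessian at a critical point. -/
theorem energyCoeff_det (hst : t ^ 2 - s ^ 2 ≠ 0)
    (hs : energyCoeff l μ₁ μ₂ m 0 * s + n * t = 0)
    (ht : energyCoeff l μ₁ μ₂ m 3 * t + n * s = 0) :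
    (t ^ 2 - s ^ 2) * (energyCoeff l μ₁ μ₂ m 1 * energyCoeff l μ₁ μ₂ m 4 - n ^ 2)
        = (l 0 ^ 2 - l 1 ^ 2) * (l 2 ^ 2 - l 3 ^ 2)
          * (s ^ 2 * (energyDividedDiff l μ₁ μ₂ 0 * energyDividedDiff l μ₁ μ₂ 3)
            - t ^ 2 * (energyDividedDiff l μ₁ μ₂ 1 * energyDividedDiff l μ₁ μ₂ 2)) ∧
    (t ^ 2 - s ^ 2) * (energyCoeff l μ₁ μ₂ m 2 * energyCoeff l μ₁ μ₂ m 5 - n ^ 2)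
        = (l 0 ^ 2 - l 2 ^ 2) * (l 1 ^ 2 - l 3 ^ 2)
          * (s ^ 2 * (energyDividedDiff l μ₁ μ₂ 0 * energyDividedDiff l μ₁ μ₂ 3)
            - t ^ 2 * (energyDividedDiff l μ₁ μ₂ 1 * energyDividedDiff l μ₁ μ₂ 2)) := by
  obtain ⟨e1, e4, e2, e5, en⟩ := energyCoeff_mul hpos hs ht
  constructor
  · apply mul_left_cancel₀ hst
    have : (t ^ 2 - s ^ 2) * ((t ^ 2 - s ^ 2)
        * (energyCoeff l μ₁ μ₂ m 1 * energyCoeff l μ₁ μ₂ m 4 - n ^ 2))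
        = ((t ^ 2 - s ^ 2) * energyCoeff l μ₁ μ₂ m 1)
          * ((t ^ 2 - s ^ 2) * energyCoeff l μ₁ μ₂ m 4) - ((t ^ 2 - s ^ 2) * n) ^ 2 := by ring
    rw [this, e1, e4, en]
    simp only [energyDividedDiff]
    ring
  · apply mul_left_cancel₀ hst
    have : (t ^ 2 - s ^ 2) * ((t ^ 2 - s ^ 2)
        * (energyCoeff l μ₁ μ₂ m 2 * energyCoeff l μ₁ μ₂ m 5 - n ^ 2))
        = ((t ^ 2 - s ^ 2) * energyCoeff l μ₁ μ₂ m 2)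
          * ((t ^ 2 - s ^ 2) * energyCoeff l μ₁ μ₂ m 5) - ((t ^ 2 - s ^ 2) * n) ^ 2 := by ring
    rw [this, e2, e5, en]
    simp only [energyDividedDiff]
    ring

end

/-- If `w` lies outside `[u₄, u₁]`, then both transverse blocks of the Hessian have a positive
diagonal entry. The reason is that the three numbers `(u₃ - u₄)(w - u₂) - (u₁ - u₂)(w - u₄)`,
`(u₂ - u₄)(w - u₃) - (u₁ - u₃)(w - u₄)` and `(w - u₁)(w - u₄) - (w - u₂)(w - u₃)` coincide. -/
theorem divided_diff_pos {u₁ u₂ u₃ u₄ w S T : ℝ} (h12 : u₂ < u₁) (h23 : u₃ < u₂) (h34 : u₄ < u₃)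
    (hS : 0 ≤ S) (hST : S < T)
    (hQ : T * ((w - u₂) * (w - u₃)) < S * ((w - u₁) * (w - u₄))) (hw : w < u₄ ∨ u₁ < w) :
    0 < T * (u₃ - u₄) * (w - u₂) - S * (u₁ - u₂) * (w - u₄) ∧
    0 < T * (u₂ - u₄) * (w - u₃) - S * (u₁ - u₃) * (w - u₄) := by
  have hprod : 0 < (w - u₁) * (w - u₄) := by
    rcases hw with hw | hw
    · exact mul_pos_of_neg_of_neg (by linarith) (by linarith)
    · exact mul_pos (by linarith) (by linarith)
  have hZ : 0 < (w - u₁) * (w - u₄) - (w - u₂) * (w - u₃) := by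
    have : T * ((w - u₂) * (w - u₃)) < T * ((w - u₁) * (w - u₄)) :=
      hQ.trans (mul_lt_mul_of_pos_right hST hprod)
    linarith [lt_of_mul_lt_mul_left this (by linarith)]
  have hTZ := mul_pos (by linarith : 0 < T) hZ
  rcases hw with hw | hw
  · have h1 : 0 < u₁ - w := by linarith
    have hTZ2 := mul_pos hTZ (by linarith : 0 < u₂ - w)
    have hTZ3 := mul_pos hTZ (by linarith : 0 < u₃ - w)
    constructor
    · refine pos_of_mul_pos_right (?_ : 0 < (u₁ - w) * _) h1.le
      have := mul_lt_mul_of_pos_left hQ (by linarith : 0 < u₁ - u₂)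
      linarith
    · refine pos_of_mul_pos_right (?_ : 0 < (u₁ - w) * _) h1.le
      have := mul_lt_mul_of_pos_left hQ (by linarith : 0 < u₁ - u₃)
      linarith
  · have h4 : 0 < w - u₄ := by linarith
    constructor
    · have := mul_pos (mul_pos (by linarith : 0 < T - S) (by linarith : 0 < u₁ - u₂)) h4
      linarith
    · have := mul_pos (mul_pos (by linarith : 0 < T - S) (by linarith : 0 < u₁ - u₃)) h4
      linarith

/-! ### The Hessian as a function of the ratio `b² / a²` -/

/-- On the orbit, `a` and `b` are determined by `a² + b² = 2 c₁`, `a b = c₂` and `|b| < a`. -/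
theorem orbit_parameters {c₁ c₂ a b : ℝ} (hc : |c₂| < c₁) (ha : a = orbitA c₁ c₂)
    (hb : b = orbitB c₁ c₂) :
    0 < a ∧ b ^ 2 < a ^ 2 ∧ a ^ 2 + b ^ 2 = 2 * c₁ ∧ a * b = c₂ := by
  have hp : 0 < c₁ + c₂ := by linarith [neg_abs_le c₂]
  have hm : 0 < c₁ - c₂ := by linarith [le_abs_self c₂]
  have h2 : (1 / √2) ^ 2 = 1 / 2 := by rw [div_pow, Real.sq_sqrt (by norm_num)]; norm_num
  have h20 : 0 < 1 / √2 := by positivity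
  have hp2 := Real.sq_sqrt hp.le
  have hm2 := Real.sq_sqrt hm.le
  have hp0 := Real.sqrt_pos.2 hp
  have hm0 := Real.sqrt_pos.2 hm
  rw [orbitA] at ha
  rw [orbitB] at hb
  generalize 1 / √2 = k at *
  generalize √(c₁ + c₂) = p at *
  generalize √(c₁ - c₂) = q at *
  subst ha hb
  have hpq := mul_pos hp0 hm0
  refine ⟨by positivity, ?_, ?_, ?_⟩
  · rw [mul_pow, mul_pow, h2]; linarith
  · rw [mul_pow, mul_pow, h2]; linarith
  · linear_combination (p ^ 2 - q ^ 2) * h2 + 1 / 2 * (hp2 - hm2)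

/-- The affine change of parameter that turns `g(p)` into the pencil in `w`. -/
noncomputable def pencilParameter (l : Fin 4 → ℝ) (p : ℝ) : ℝ :=
  l 1 ^ 2 + (p - 1) * ((l 0 + l 1) * (l 1 + l 2) * (l 1 + l 3)) / (l 0 + l 1 + l 2 + l 3)

/-- Where the pencil is negative and `α₂ < r < 1`, the parameter `w` lies outside
`[λ₄², λ₁²]`. Otherwise the pencil would be negative for `r = α₂` too, where its discriminant
vanishes. -/
theorem pencilParameter_outside {l : Fin 4 → ℝ} (hu : StrictAnti fun i => l i ^ 2) {r w : ℝ}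
    (hr : r ∈ Set.Ioo (bifurcationRoot₂ l) 1)
    (hw : (w - l 1 ^ 2) * (w - l 2 ^ 2) < r * ((w - l 0 ^ 2) * (w - l 3 ^ 2))) :
    w < l 3 ^ 2 ∨ l 0 ^ 2 < w := by
  by_contra! hcon
  have h1 : (w - l 0 ^ 2) * (w - l 3 ^ 2) ≤ 0 :=
    mul_nonpos_of_nonpos_of_nonneg (by linarith) (by linarith)
  have h2 := mul_le_mul_of_nonpos_right hr.1.le h1
  have h3 := bifurcationQuadratic_eq_discrim l (bifurcationRoot₂ l) w
  rw [(bifurcationQuadratic_eq_zero_iff hu _).2 (Or.inr rfl)] at h3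
  have h4 : 0 < 1 - bifurcationRoot₂ l := by linarith [hr.1, hr.2]
  have h5 := mul_neg_of_pos_of_neg (by linarith : 0 < 4 * (1 - bifurcationRoot₂ l))
    (by linarith : (w - l 1 ^ 2) * (w - l 2 ^ 2)
      - bifurcationRoot₂ l * ((w - l 0 ^ 2) * (w - l 3 ^ 2)) < 0)
  rw [h3] at h5
  linarith [sq_nonneg (2 * (1 - bifurcationRoot₂ l) * w
    - (l 1 ^ 2 + l 2 ^ 2 - bifurcationRoot₂ l * (l 0 ^ 2 + l 3 ^ 2)))]

theorem exists_critical_multipliers {s t : ℝ} (hst : s ^ 2 ≠ t ^ 2) (l : Fin 4 → ℝ) (μ₁ μ₂ : ℝ) :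
    ∃ m n : ℝ, fderiv ℝ (energyFunction l μ₁ μ₂ m n) (equilibrium₁ s t) = 0 := by
  have h : t ^ 2 - s ^ 2 ≠ 0 := sub_ne_zero.2 hst.symm
  have e0 : ∀ m, energyCoeff l μ₁ μ₂ m 0 = energyCoeff l μ₁ μ₂ 0 0 + m := fun m => by
    simp [energyCoeff]
  have e3 : ∀ m, energyCoeff l μ₁ μ₂ m 3 = energyCoeff l μ₁ μ₂ 0 3 + m := fun m => by
    simp [energyCoeff]
  have key : ∀ m n, (energyCoeff l μ₁ μ₂ 0 0 + m) * s + n * t = 0 →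
      (energyCoeff l μ₁ μ₂ 0 3 + m) * t + n * s = 0 →
      fderiv ℝ (energyFunction l μ₁ μ₂ m n) (equilibrium₁ s t) = 0 := fun m n h0 h3 => by
    rw [fderiv_energyFunction_equilibrium₁_eq_zero_iff, e0, e3]
    exact ⟨h0, h3⟩
  refine ⟨(s ^ 2 * energyCoeff l μ₁ μ₂ 0 0 - t ^ 2 * energyCoeff l μ₁ μ₂ 0 3) / (t ^ 2 - s ^ 2),
    s * t * (energyCoeff l μ₁ μ₂ 0 3 - energyCoeff l μ₁ μ₂ 0 0) / (t ^ 2 - s ^ 2), key _ _ ?_ ?_⟩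
  · field_simp; ring
  · field_simp; ring

section
variable {l : Fin 4 → ℝ} (hpos : ∀ i j, i ≠ j → 0 < l i + l j)
include hpos

theorem sum_pos_of_pairs : 0 < l 0 + l 1 + l 2 + l 3 := by
  linarith [hpos 0 1 (by decide), hpos 2 3 (by decide)]

theorem rootDividedDiff_pos : 0 < rootDividedDiff l := by
  have h := sum_pos_of_pairs hpos
  have h01 := hpos 0 1 (by decide)
  have h02 := hpos 0 2 (by decide)
  have h03 := hpos 0 3 (by decide)
  have h12 := hpos 1 2 (by decide)
  have h13 := hpos 1 3 (by decide)
  have h23 := hpos 2 3 (by decide)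
  rw [rootDividedDiff]
  positivity

theorem lyapunovQuadratic_eq (a b p : ℝ) :
    lyapunovQuadratic l a b p = (l 0 + l 1 + l 2 + l 3) ^ 2 / ((l 0 + l 1) * (l 1 + l 3))
      * (a ^ 2 * ((pencilParameter l p - l 1 ^ 2) * (pencilParameter l p - l 2 ^ 2))
        - b ^ 2 * ((pencilParameter l p - l 0 ^ 2) * (pencilParameter l p - l 3 ^ 2))) := by
  have h := (sum_pos_of_pairs hpos).ne'
  have h01 := (hpos 0 1 (by decide)).ne'
  have h13 := (hpos 1 3 (by decide)).ne'
  rw [lyapunovQuadratic, pencilParameter]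
  field_simp
  ring

theorem energyDividedDiff_lyapunov (p : ℝ) (i : Fin 4) :
    energyDividedDiff l 1 (p / (2 * (l 0 + l 2) * (l 0 + l 3) * (l 2 + l 3))) i
      = rootDividedDiff l * (pencilParameter l p - l i ^ 2) := by
  have h := (sum_pos_of_pairs hpos).ne'
  have h01 := (hpos 0 1 (by decide)).ne'
  have h02 := (hpos 0 2 (by decide)).ne'
  have h03 := (hpos 0 3 (by decide)).ne'
  have h12 := (hpos 1 2 (by decide)).ne'
  have h13 := (hpos 1 3 (by decide)).ne'
  have h23 := (hpos 2 3 (by decide)).ne'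
  rw [energyDividedDiff, pencilParameter, rootDividedDiff]
  field_simp
  ring

theorem exists_lyapunovQuadratic_roots (hu : StrictAnti fun i => l i ^ 2) {a b : ℝ} (ha : 0 < a)
    (hab : b ^ 2 / a ^ 2 ∈ Set.Ioo (bifurcationRoot₂ l) 1) :
    ∃ p₃ p₄ : ℝ, p₃ < p₄ ∧
      (∀ p, lyapunovQuadratic l a b p = 0 ↔ p = p₃ ∨ p = p₄) ∧
      (∀ p, lyapunovQuadratic l a b p < 0 ↔ p ∈ Set.Ioo p₃ p₄) := by
  have hsum := sum_pos_of_pairs hpos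
  have h01 := hpos 0 1 (by decide)
  have h12 := hpos 1 2 (by decide)
  have h13 := hpos 1 3 (by decide)
  have hba : 0 < a ^ 2 - b ^ 2 := by
    have := (div_lt_one (by positivity)).1 hab.2
    linarith
  have hS : 0 < (l 0 + l 1) * (l 1 + l 3) * (l 1 + l 2) ^ 2 * (a ^ 2 - b ^ 2) := by positivity
  have hdisc := bifurcationQuadratic_pos hu hab.1
  have hdisc' : 0 < ((l 0 + l 1 + l 2 + l 3) * (l 1 + l 2) * a ^ 2) ^ 2
      * bifurcationQuadratic l (b ^ 2 / a ^ 2) := by positivity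
  obtain ⟨p₃, p₄, h34, hp⟩ := exists_roots_of_discrim_pos hS
    (B := -(l 1 + l 2) *
        ((l 1 + l 2) * ((l 0 + l 1) * (l 1 + l 3) + (l 0 + l 2) * (l 2 + l 3)) * a ^ 2
          - (l 0 + l 3) * ((l 0 + l 1) * (l 0 + l 2) + (l 1 + l 3) * (l 2 + l 3)) * b ^ 2))
    (C := (l 0 + l 2) * (l 2 + l 3) * ((l 1 + l 2) ^ 2 * a ^ 2 - (l 0 + l 3) ^ 2 * b ^ 2)) (by
      refine hdisc'.trans_eq ?_
      rw [bifurcationQuadratic]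
      field_simp
      ring)
  have hg : ∀ p, lyapunovQuadratic l a b p
      = (l 0 + l 1) * (l 1 + l 3) * (l 1 + l 2) ^ 2 * (a ^ 2 - b ^ 2)
        * ((p - p₃) * (p - p₄)) := fun p => by rw [← hp, lyapunovQuadratic]
  refine ⟨p₃, p₄, h34, fun p => ?_, fun p => ?_⟩
  · rw [hg, mul_eq_zero_iff_left hS.ne', mul_eq_zero, sub_eq_zero, sub_eq_zero]
  · rw [hg, ← smul_eq_mul, smul_neg_iff_of_pos_left hS, mul_neg_iff, Set.mem_Ioo]
    constructor
    · rintro (h | h)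
      · exact ⟨by linarith, by linarith⟩
      · linarith
    · rintro ⟨h, h'⟩
      exact Or.inl ⟨by linarith, by linarith⟩

theorem blocks_pos_of_lyapunovQuadratic_neg (hu : StrictAnti fun i => l i ^ 2)
    {s t p m n μ : ℝ} (hμ : μ = p / (2 * (l 0 + l 2) * (l 0 + l 3) * (l 2 + l 3)))
    (ht0 : t ≠ 0) (hst : s ^ 2 / t ^ 2 ∈ Set.Ioo (bifurcationRoot₂ l) 1)
    (hp : lyapunovQuadratic l t s p < 0)
    (hcrit : fderiv ℝ (energyFunction l 1 μ m n) (equilibrium₁ s t) = 0) :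
    0 < energyCoeff l 1 μ m 1 ∧ 0 < energyCoeff l 1 μ m 2 ∧
      n ^ 2 < energyCoeff l 1 μ m 1 * energyCoeff l 1 μ m 4 ∧
      n ^ 2 < energyCoeff l 1 μ m 2 * energyCoeff l 1 μ m 5 := by
  have h01 := hpos 0 1 (by decide)
  have h13 := hpos 1 3 (by decide)
  have hsum := sum_pos_of_pairs hpos
  have hd := rootDividedDiff_pos hpos
  have u01 : l 1 ^ 2 < l 0 ^ 2 := hu (show (0 : Fin 4) < 1 by decide)
  have u12 : l 2 ^ 2 < l 1 ^ 2 := hu (show (1 : Fin 4) < 2 by decide)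
  have u23 : l 3 ^ 2 < l 2 ^ 2 := hu (show (2 : Fin 4) < 3 by decide)
  have ht2 : 0 < t ^ 2 := by positivity
  have hlt : s ^ 2 < t ^ 2 := (div_lt_one ht2).1 hst.2
  have hlt' : 0 < t ^ 2 - s ^ 2 := by linarith
  rw [lyapunovQuadratic_eq hpos, ← smul_eq_mul, smul_neg_iff_of_pos_left (by positivity)] at hp
  obtain ⟨hs, ht⟩ := (fderiv_energyFunction_equilibrium₁_eq_zero_iff ..).1 hcrit
  obtain ⟨e1, -, e2, -, -⟩ := energyCoeff_mul hpos hs ht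
  obtain ⟨d1, d2⟩ := energyCoeff_det hpos hlt'.ne' hs ht
  have hf : ∀ i, energyDividedDiff l 1 μ i
      = rootDividedDiff l * (pencilParameter l p - l i ^ 2) := fun i => by
    rw [hμ]; exact energyDividedDiff_lyapunov hpos p i
  simp only [hf] at e1 e2 d1 d2
  set w := pencilParameter l p with hw
  have hQ : t ^ 2 * ((w - l 1 ^ 2) * (w - l 2 ^ 2)) < s ^ 2 * ((w - l 0 ^ 2) * (w - l 3 ^ 2)) := by
    linarith
  have hout : w < l 3 ^ 2 ∨ l 0 ^ 2 < w := by
    refine pencilParameter_outside hu hst ?_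
    rw [div_mul_eq_mul_div, lt_div_iff₀ ht2]
    linarith
  obtain ⟨q1, q2⟩ := divided_diff_pos u01 u12 u23 (sq_nonneg s) hlt hQ hout
  refine ⟨?_, ?_, ?_, ?_⟩
  · refine pos_of_mul_pos_right (?_ : 0 < (t ^ 2 - s ^ 2) * _) hlt'.le
    rw [e1]
    linarith [mul_pos hd q1]
  · refine pos_of_mul_pos_right (?_ : 0 < (t ^ 2 - s ^ 2) * _) hlt'.le
    rw [e2]
    linarith [mul_pos hd q2]
  · refine sub_pos.1 (pos_of_mul_pos_right (?_ : 0 < (t ^ 2 - s ^ 2) * _) hlt'.le)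
    rw [d1]
    refine mul_pos (mul_pos (by linarith) (by linarith)) ?_
    linarith [mul_pos (pow_pos hd 2) (sub_pos.2 hQ)]
  · refine sub_pos.1 (pos_of_mul_pos_right (?_ : 0 < (t ^ 2 - s ^ 2) * _) hlt'.le)
    rw [d2]
    refine mul_pos (mul_pos (by linarith) (by linarith)) ?_
    linarith [mul_pos (pow_pos hd 2) (sub_pos.2 hQ)]

/-- Where `g(p)` is negative, the Lyapunov candidate shows the stability of the equilibrium. -/
theorem stable_of_lyapunovQuadratic_neg (hu : StrictAnti fun i => l i ^ 2)
    {s t p m n c₁ c₂ : ℝ} (hM : equilibrium₁ s t ∈ orbit c₁ c₂)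
    (ht0 : t ≠ 0) (hst : s ^ 2 / t ^ 2 ∈ Set.Ioo (bifurcationRoot₂ l) 1)
    (hp : lyapunovQuadratic l t s p < 0)
    (hcrit : fderiv ℝ (lyapunovCandidate l p m n) (equilibrium₁ s t) = 0) :
    (∀ S, IsNonlinearlyStableOn (rigidBodyField l) S (equilibrium₁ s t)) ∧
    HessianPosDefOn (lyapunovCandidate l p m n) (equilibrium₁ s t)
      (casimirKernel (equilibrium₁ s t)) ∧
    IsLyapunovFunctionOn (lyapunovCandidate l p m n) (rigidBodyField l) (orbit c₁ c₂)
      (equilibrium₁ s t) := by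
  have hne : s ^ 2 ≠ t ^ 2 := ((div_lt_one (by positivity)).1 hst.2).ne
  rw [lyapunovCandidate] at *
  obtain ⟨h1, h2, hd1, hd2⟩ := blocks_pos_of_lyapunovQuadratic_neg hpos hu rfl ht0 hst hp hcrit
  obtain ⟨K, c, hc, ε, hε, hgrow⟩ := penalizedEnergy_growth hne hcrit h1 h2 hd1 hd2
  have hzero := fderiv_energyFunction_rigidBodyField hpos
  have z1 := hzero 0 0 1 0
  have z2 := hzero 0 0 0 1
  rw [energyFunction_casimir₁] at z1
  rw [energyFunction_casimir₂] at z2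
  refine ⟨fun S => isNonlinearlyStableOn_of_conserved
    (fun N => (hasFDerivAt_penalizedEnergy ..).differentiableAt) (fun N => ?_) hc hε hgrow S,
    hessianPosDefOn_of_blocks hne h1 h2 hd1 hd2,
    fun N => (hasFDerivAt_energyFunction ..).differentiableAt, fun N _ => (hzero ..).le,
    ε, hε, fun N hN hNM hdist => ?_⟩
  · rw [(hasFDerivAt_penalizedEnergy ..).fderiv]
    simp [hzero, z1, z2]
  · have h := hgrow N hdist
    have hpos' : 0 < c * dist N (equilibrium₁ s t) ^ 2 := by
      have := dist_pos.2 hNM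
      positivity
    simp only [penalizedEnergy, hN.1, hN.2, hM.1, hM.2] at h
    linarith

/-- At `r = α₂` the determinant of a transverse block of the Hessian is, up to a positive factor,
minus a quadratic with vanishing discriminant, so neither definite sign is possible. -/
theorem not_definite_of_ratio_eq (hu : StrictAnti fun i => l i ^ 2) {s t μ₁ μ₂ m n : ℝ}
    (ht0 : t ≠ 0) (hlt : s ^ 2 < t ^ 2) (hst : s ^ 2 / t ^ 2 = bifurcationRoot₂ l)
    (hcrit : fderiv ℝ (energyFunction l μ₁ μ₂ m n) (equilibrium₁ s t) = 0) :
    ¬ HessianPosDefOn (energyFunction l μ₁ μ₂ m n) (equilibrium₁ s t)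
        (casimirKernel (equilibrium₁ s t)) ∧
    ¬ HessianNegDefOn (energyFunction l μ₁ μ₂ m n) (equilibrium₁ s t)
        (casimirKernel (equilibrium₁ s t)) := by
  have u01 : l 1 ^ 2 < l 0 ^ 2 := hu (show (0 : Fin 4) < 1 by decide)
  have u23 : l 3 ^ 2 < l 2 ^ 2 := hu (show (2 : Fin 4) < 3 by decide)
  have ht2 : 0 < t ^ 2 := by positivity
  have hlt' : 0 < t ^ 2 - s ^ 2 := by linarith
  obtain ⟨hs, ht⟩ := (fderiv_energyFunction_equilibrium₁_eq_zero_iff ..).1 hcrit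
  obtain ⟨d1, -⟩ := energyCoeff_det hpos hlt'.ne' hs ht
  have hdet : energyCoeff l μ₁ μ₂ m 1 * energyCoeff l μ₁ μ₂ m 4 - n ^ 2 ≤ 0 := by
    refine nonpos_of_mul_nonpos_right (?_ : (t ^ 2 - s ^ 2) * _ ≤ 0) hlt'
    rw [d1]
    refine mul_nonpos_of_nonneg_of_nonpos (mul_nonneg (by linarith) (by linarith)) ?_
    have hz := (bifurcationQuadratic_eq_zero_iff hu _).2 (Or.inr hst)
    obtain ⟨r, hr⟩ : ∃ r, r = s ^ 2 / t ^ 2 := ⟨_, rfl⟩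
    have hsr : s ^ 2 = r * t ^ 2 := by rw [hr]; field_simp
    rw [← hr] at hz
    have hr1 : 0 < 1 - r := by
      rw [hr, sub_pos]; exact (div_lt_one ht2).2 hlt
    rw [hsr]
    have hmain : 0 ≤ 4 * (1 - r) * (energyDividedDiff l μ₁ μ₂ 1 * energyDividedDiff l μ₁ μ₂ 2
        - r * (energyDividedDiff l μ₁ μ₂ 0 * energyDividedDiff l μ₁ μ₂ 3)) := by
      obtain ⟨y, hy⟩ : ∃ y, ∀ i, energyDividedDiff l μ₁ μ₂ i
          = y - μ₁ * rootDividedDiff l * l i ^ 2 :=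
        ⟨2 * μ₂ - μ₁ / ((l 0 + l 2) * (l 0 + l 3) * (l 2 + l 3))
          + μ₁ * rootDividedDiff l * l 1 ^ 2, fun i => by rw [energyDividedDiff]; ring⟩
      simp only [hy]
      generalize μ₁ * rootDividedDiff l = e
      have : 4 * (1 - r) * ((y - e * l 1 ^ 2) * (y - e * l 2 ^ 2)
            - r * ((y - e * l 0 ^ 2) * (y - e * l 3 ^ 2)))
          = (2 * (1 - r) * y - e * (l 1 ^ 2 + l 2 ^ 2 - r * (l 0 ^ 2 + l 3 ^ 2))) ^ 2
            - e ^ 2 * bifurcationQuadratic l r := by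
        rw [bifurcationQuadratic]; ring
      rw [this, hz, mul_zero, sub_zero]
      exact sq_nonneg _
    have h1 := nonneg_of_mul_nonneg_right hmain (by linarith)
    linarith [mul_nonneg ht2.le h1]
  have hmem : ∀ x y : ℝ, !₂[0, x, 0, 0, y, 0] ∈ casimirKernel (equilibrium₁ s t) := fun x y => by
    rw [mem_casimirKernel hlt.ne]; simp
  have hval : ∀ x y : ℝ, fderiv ℝ (fderiv ℝ (energyFunction l μ₁ μ₂ m n)) (equilibrium₁ s t)
      !₂[0, x, 0, 0, y, 0] !₂[0, x, 0, 0, y, 0]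
      = energyCoeff l μ₁ μ₂ m 1 * x ^ 2 + energyCoeff l μ₁ μ₂ m 4 * y ^ 2 + 2 * n * x * y := by
    intro x y
    rw [fderiv_fderiv_energyFunction, pairedBilin_apply]
    simp
    ring
  have hne : ∀ x y : ℝ, x ≠ 0 ∨ y ≠ 0 → (!₂[0, x, 0, 0, y, 0] : So4) ≠ 0 := by
    intro x y hxy h
    have hx : x = 0 := congrArg (fun v : So4 => v 1) h
    have hy : y = 0 := congrArg (fun v : So4 => v 4) h
    tauto
  constructor
  · intro h
    have h1 := h _ (hmem 1 0) (hne 1 0 (by simp))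
    rw [hval] at h1
    have hk : 0 < energyCoeff l μ₁ μ₂ m 1 := by linarith
    have h2 := h _ (hmem (-n) (energyCoeff l μ₁ μ₂ m 1)) (hne _ _ (Or.inr hk.ne'))
    rw [hval] at h2
    linarith [mul_nonpos_of_nonneg_of_nonpos hk.le hdet]
  · intro h
    have h1 := h _ (hmem 1 0) (hne 1 0 (by simp))
    rw [hval] at h1
    have hk : energyCoeff l μ₁ μ₂ m 1 < 0 := by linarith
    have h2 := h _ (hmem (-n) (energyCoeff l μ₁ μ₂ m 1)) (hne _ _ (Or.inr hk.ne))
    rw [hval] at h2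
    linarith [mul_nonneg_of_nonpos_of_nonpos hk.le hdet]

end

/-! ### The linearization at the equilibria -/

/-- The matrix `P(x, y)` of the equations `(x₂, y₂)' = P(x₁, y₁) (x₃, y₃)`. -/
noncomputable def transverseP (l : Fin 4 → ℝ) (x y : ℝ) : Matrix (Fin 2) (Fin 2) ℝ :=
  !![(1 / (l 1 + l 2) - 1 / (l 0 + l 1)) * x, (1 / (l 0 + l 3) - 1 / (l 2 + l 3)) * y;
     (1 / (l 0 + l 3) - 1 / (l 0 + l 1)) * y, (1 / (l 1 + l 2) - 1 / (l 2 + l 3)) * x]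

/-- The matrix `Q(x, y)` of the equations `(x₃, y₃)' = Q(x₁, y₁) (x₂, y₂)`. -/
noncomputable def transverseQ (l : Fin 4 → ℝ) (x y : ℝ) : Matrix (Fin 2) (Fin 2) ℝ :=
  !![(1 / (l 0 + l 2) - 1 / (l 1 + l 2)) * x, (1 / (l 1 + l 3) - 1 / (l 0 + l 3)) * y;
     (1 / (l 0 + l 2) - 1 / (l 0 + l 3)) * y, (1 / (l 1 + l 3) - 1 / (l 1 + l 2)) * x]

theorem rigidBodyField_transverse (l : Fin 4 → ℝ) (N : So4) :
    rigidBodyField l N 1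
        = transverseP l (N 0) (N 3) 0 0 * N 2 + transverseP l (N 0) (N 3) 0 1 * N 5 ∧
    rigidBodyField l N 4
        = transverseP l (N 0) (N 3) 1 0 * N 2 + transverseP l (N 0) (N 3) 1 1 * N 5 ∧
    rigidBodyField l N 2
        = transverseQ l (N 0) (N 3) 0 0 * N 1 + transverseQ l (N 0) (N 3) 0 1 * N 4 ∧
    rigidBodyField l N 5
        = transverseQ l (N 0) (N 3) 1 0 * N 1 + transverseQ l (N 0) (N 3) 1 1 * N 4 := by
  refine ⟨?_, ?_, ?_, ?_⟩ <;> simp [rigidBodyField, transverseP, transverseQ] <;> ring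

/-- The linearization of the rigid body field at `M¹_{s,t}`. -/
theorem fderiv_rigidBodyField_equilibrium₁ (l : Fin 4 → ℝ) (s t : ℝ) (v : So4) :
    fderiv ℝ (rigidBodyField l) (equilibrium₁ s t) v
      = !₂[0, transverseP l s t 0 0 * v 2 + transverseP l s t 0 1 * v 5,
          transverseQ l s t 0 0 * v 1 + transverseQ l s t 0 1 * v 4, 0,
          transverseP l s t 1 0 * v 2 + transverseP l s t 1 1 * v 5,
          transverseQ l s t 1 0 * v 1 + transverseQ l s t 1 1 * v 4] := by
  set L : So4 := !₂[0, transverseP l s t 0 0 * v 2 + transverseP l s t 0 1 * v 5,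
          transverseQ l s t 0 0 * v 1 + transverseQ l s t 0 1 * v 4, 0,
          transverseP l s t 1 0 * v 2 + transverseP l s t 1 1 * v 5,
          transverseQ l s t 1 0 * v 1 + transverseQ l s t 1 1 * v 4] with hL
  have hexp : ∀ h : ℝ, rigidBodyField l (equilibrium₁ s t + h • v)
      = h • L + h ^ 2 • rigidBodyField l v := by
    intro h
    ext i
    fin_cases i <;>
      simp [rigidBodyField, equilibrium₁, hL, transverseP, transverseQ] <;> ring
  have hline : HasDerivAt (fun h : ℝ => equilibrium₁ s t + h • v) v 0 := by
    simpa using ((hasDerivAt_id (0 : ℝ)).smul_const v).const_add (equilibrium₁ s t)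
  have hdiff : HasFDerivAt (rigidBodyField l) (fderiv ℝ (rigidBodyField l) (equilibrium₁ s t))
      (equilibrium₁ s t + (0 : ℝ) • v) := by
    rw [zero_smul, add_zero]
    exact ((contDiff_rigidBodyField l).differentiable (by norm_num) _).hasFDerivAt
  have h1 := hdiff.comp_hasDerivAt (0 : ℝ) hline
  have h2 := ((hasDerivAt_id (0 : ℝ)).smul_const L).add
    (((hasDerivAt_id (0 : ℝ)).pow 2).smul_const (rigidBodyField l v))
  have h3 := (h1.congr_of_eventuallyEq
    (Filter.Eventually.of_forall fun h => (hexp h).symm)).unique h2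
  simpa using h3

/-- A nonzero eigenvalue `z` of the linearization has `z²` as an eigenvalue of `Q P`. -/
theorem eigenvalue_linearization {l : Fin 4 → ℝ} {s t : ℝ} {z : ℂ}
    (hz : ((fderiv ℝ (rigidBodyField l) (equilibrium₁ s t)).toLinearMap.charpoly.map
      (algebraMap ℝ ℂ)).IsRoot z) (hz0 : z ≠ 0) :
    z ^ 4 - ((transverseQ l s t * transverseP l s t).trace : ℝ) * z ^ 2
      + ((transverseQ l s t * transverseP l s t).det : ℝ) = 0 := by
  rw [← LinearMap.charpoly_toMatrix _ (EuclideanSpace.basisFun (Fin 6) ℝ).toBasis,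
    ← Matrix.charpoly_map, Polynomial.IsRoot, Matrix.eval_charpoly,
    ← Matrix.exists_mulVec_eq_zero_iff] at hz
  obtain ⟨v, hv0, hv⟩ := hz
  have hA : ∀ i j, LinearMap.toMatrix (EuclideanSpace.basisFun (Fin 6) ℝ).toBasis
      (EuclideanSpace.basisFun (Fin 6) ℝ).toBasis
      (fderiv ℝ (rigidBodyField l) (equilibrium₁ s t)).toLinearMap i j
      = fderiv ℝ (rigidBodyField l) (equilibrium₁ s t) (EuclideanSpace.single j 1) i :=
    fun i j => by
    simp [LinearMap.toMatrix_apply]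
  have hrow : ∀ i, z * v i = ∑ j, (fderiv ℝ (rigidBodyField l) (equilibrium₁ s t)
      (EuclideanSpace.single j 1) i : ℂ) * v j := fun i => by
    have h := congrFun hv i
    rw [Matrix.sub_mulVec] at h
    simp only [Pi.sub_apply, Pi.zero_apply, sub_eq_zero] at h
    simpa [Matrix.mulVec, dotProduct, hA, Matrix.scalar_apply, Matrix.diagonal_apply] using h
  simp only [fderiv_rigidBodyField_equilibrium₁] at hrow
  have e0 := hrow 0
  have e1 := hrow 1
  have e2 := hrow 2
  have e3 := hrow 3
  have e4 := hrow 4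
  have e5 := hrow 5
  simp [Fin.sum_univ_succ, hz0] at e0 e1 e2 e3 e4 e5
  rw [Matrix.trace_fin_two, Matrix.det_fin_two]
  simp only [Matrix.mul_apply, Fin.sum_univ_two]
  push_cast
  generalize (transverseP l s t 0 0 : ℂ) = p₀₀ at *
  generalize (transverseP l s t 0 1 : ℂ) = p₀₁ at *
  generalize (transverseP l s t 1 0 : ℂ) = p₁₀ at *
  generalize (transverseP l s t 1 1 : ℂ) = p₁₁ at *
  generalize (transverseQ l s t 0 0 : ℂ) = q₀₀ at *
  generalize (transverseQ l s t 0 1 : ℂ) = q₀₁ at *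
  generalize (transverseQ l s t 1 0 : ℂ) = q₁₀ at *
  generalize (transverseQ l s t 1 1 : ℂ) = q₁₁ at *
  have f2 : z ^ 2 * v 2 = (q₀₀ * p₀₀ + q₀₁ * p₁₀) * v 2 + (q₀₀ * p₀₁ + q₀₁ * p₁₁) * v 5 := by
    linear_combination z * e2 + q₀₀ * e1 + q₀₁ * e4
  have f5 : z ^ 2 * v 5 = (q₁₀ * p₀₀ + q₁₁ * p₁₀) * v 2 + (q₁₀ * p₀₁ + q₁₁ * p₁₁) * v 5 := by
    linear_combination z * e5 + q₁₀ * e1 + q₁₁ * e4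
  by_contra hg
  have v2 : v 2 = 0 := by
    refine (mul_eq_zero.1 (?_ : _ * v 2 = 0)).resolve_left hg
    linear_combination (z ^ 2 - (q₁₀ * p₀₁ + q₁₁ * p₁₁)) * f2 + (q₀₀ * p₀₁ + q₀₁ * p₁₁) * f5
  have v5 : v 5 = 0 := by
    refine (mul_eq_zero.1 (?_ : _ * v 5 = 0)).resolve_left hg
    linear_combination (z ^ 2 - (q₀₀ * p₀₀ + q₀₁ * p₁₀)) * f5 + (q₁₀ * p₀₀ + q₁₁ * p₁₀) * f2
  have v1 : v 1 = 0 := by simpa [v2, v5, hz0] using e1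
  have v4 : v 4 = 0 := by simpa [v2, v5, hz0] using e4
  apply hv0
  ext i
  fin_cases i <;> simp [*]

/-- If the eigenvalues of `Q P` coincide and are not positive, then those of the linearization are
imaginary. -/
theorem isSpectrallyStable_of_double_root {l : Fin 4 → ℝ} {s t δ : ℝ} (hδ : 0 ≤ δ)
    (htr : (transverseQ l s t * transverseP l s t).trace = -2 * δ)
    (hdet : (transverseQ l s t * transverseP l s t).det = δ ^ 2) :
    IsSpectrallyStable (rigidBodyField l) (equilibrium₁ s t) := by
  intro z hz
  by_cases hz0 : z = 0
  · simp [hz0]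
  have h := eigenvalue_linearization hz hz0
  rw [htr, hdet] at h
  push_cast at h
  have h2 : z ^ 2 + δ = 0 := by
    have : (z ^ 2 + δ) ^ 2 = 0 := by linear_combination h
    exact pow_eq_zero_iff two_ne_zero |>.1 this
  have hre := congrArg Complex.re h2
  have him := congrArg Complex.im h2
  simp [pow_two] at hre him
  by_contra! hpos
  have : z.im = 0 := by
    have : z.re * z.im = 0 := by linarith
    exact (mul_eq_zero.1 this).resolve_left hpos.ne'
  rw [this] at hre
  nlinarith

/-- A quadratic form that increases along a hyperbolic linear system `ξ' = P η`, `η' = Q ξ`. If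
`Q P` has determinant `δ²` and `tr(Q P) + 2 δ > 0`, then `W = Q P + δ` is a multiple of a square
root of `Q P` with eigenvalues in the right half-plane. With the solution
`Y = det W + adj(W)ᵀ adj(W)` of the Lyapunov equation `Wᵀ Y + Y W = 2 det(W) tr(W)`, the form is `ξᵀ Qᵀ Y W η`. -/
theorem exists_increasing_form {P Q : Matrix (Fin 2) (Fin 2) ℝ} {δ : ℝ} (hδ : 0 < δ)
    (hdet : (Q * P).det = δ ^ 2) (htr : 0 < (Q * P).trace + 2 * δ) :
    ∃ R : Matrix (Fin 2) (Fin 2) ℝ, ∃ c > 0, ∀ x₁ x₂ y₁ y₂ : ℝ,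
      c * (x₁ ^ 2 + x₂ ^ 2 + y₁ ^ 2 + y₂ ^ 2) ≤
        (P 0 0 * y₁ + P 0 1 * y₂) * (R 0 0 * y₁ + R 0 1 * y₂)
          + (P 1 0 * y₁ + P 1 1 * y₂) * (R 1 0 * y₁ + R 1 1 * y₂)
          + (x₁ * (R 0 0 * (Q 0 0 * x₁ + Q 0 1 * x₂) + R 0 1 * (Q 1 0 * x₁ + Q 1 1 * x₂))
            + x₂ * (R 1 0 * (Q 0 0 * x₁ + Q 0 1 * x₂) + R 1 1 * (Q 1 0 * x₁ + Q 1 1 * x₂))) := by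
  have hQ : Q 0 0 * Q 1 1 - Q 0 1 * Q 1 0 ≠ 0 := by
    rw [← Matrix.det_fin_two]
    intro h
    rw [Matrix.det_mul, h, zero_mul] at hdet
    exact (pow_pos hδ 2).ne hdet
  rw [Matrix.det_fin_two] at hdet
  rw [Matrix.trace_fin_two] at htr
  obtain ⟨N, hN⟩ : ∃ N, N = Q * P := ⟨_, rfl⟩
  have n00 : N 0 0 = Q 0 0 * P 0 0 + Q 0 1 * P 1 0 := by
    rw [hN, Matrix.mul_apply, Fin.sum_univ_two]
  have n01 : N 0 1 = Q 0 0 * P 0 1 + Q 0 1 * P 1 1 := by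
    rw [hN, Matrix.mul_apply, Fin.sum_univ_two]
  have n10 : N 1 0 = Q 1 0 * P 0 0 + Q 1 1 * P 1 0 := by
    rw [hN, Matrix.mul_apply, Fin.sum_univ_two]
  have n11 : N 1 1 = Q 1 0 * P 0 1 + Q 1 1 * P 1 1 := by
    rw [hN, Matrix.mul_apply, Fin.sum_univ_two]
  rw [← hN] at hdet htr
  obtain ⟨T, hT⟩ : ∃ T, T = N 0 0 + N 1 1 + 2 * δ := ⟨_, rfl⟩
  rw [← hT] at htr
  obtain ⟨w₀, hw₀⟩ : ∃ w, w = N 0 0 + δ := ⟨_, rfl⟩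
  obtain ⟨w₃, hw₃⟩ : ∃ w, w = N 1 1 + δ := ⟨_, rfl⟩
  have hdetW : w₀ * w₃ - N 0 1 * N 1 0 = δ * T := by
    rw [hw₀, hw₃, hT]; linear_combination hdet
  have hW0 : 0 < δ * T := mul_pos hδ htr
  obtain ⟨k, hk, hkQ⟩ := exists_mul_le_sq_add_sq hQ
  obtain ⟨k', hk', hkW⟩ := exists_mul_le_sq_add_sq (hdetW ▸ hW0.ne')
  -- the entries of `Y`
  obtain ⟨Y₀, hY₀⟩ : ∃ Y, Y = δ * T + w₃ ^ 2 + N 1 0 ^ 2 := ⟨_, rfl⟩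
  obtain ⟨Y₁, hY₁⟩ : ∃ Y, Y = -(w₃ * N 0 1) - N 1 0 * w₀ := ⟨_, rfl⟩
  obtain ⟨Y₃, hY₃⟩ : ∃ Y, Y = δ * T + N 0 1 ^ 2 + w₀ ^ 2 := ⟨_, rfl⟩
  have hlyap : ∀ a b : ℝ, a * (Y₀ * (w₀ * a + N 0 1 * b) + Y₁ * (N 1 0 * a + w₃ * b))
      + b * (Y₁ * (w₀ * a + N 0 1 * b) + Y₃ * (N 1 0 * a + w₃ * b))
      = δ * T * T * (a ^ 2 + b ^ 2) := by
    intro a b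
    have hT' : T = w₀ + w₃ := by rw [hT, hw₀, hw₃]; ring
    rw [hY₀, hY₁, hY₃, ← hdetW, hT']
    ring
  -- the Cayley-Hamilton identity `W² = T N`
  have ch₀ : ∀ a b, w₀ * (w₀ * a + N 0 1 * b) + N 0 1 * (N 1 0 * a + w₃ * b)
      = T * (N 0 0 * a + N 0 1 * b) := by
    intro a b
    rw [hw₀, hw₃, hT]; linear_combination -a * hdet
  have ch₁ : ∀ a b, N 1 0 * (w₀ * a + N 0 1 * b) + w₃ * (N 1 0 * a + w₃ * b)
      = T * (N 1 0 * a + N 1 1 * b) := by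
    intro a b
    rw [hw₀, hw₃, hT]; linear_combination -b * hdet
  have hη : ∀ a b : ℝ, (N 0 0 * a + N 0 1 * b)
        * (Y₀ * (w₀ * a + N 0 1 * b) + Y₁ * (N 1 0 * a + w₃ * b))
      + (N 1 0 * a + N 1 1 * b) * (Y₁ * (w₀ * a + N 0 1 * b) + Y₃ * (N 1 0 * a + w₃ * b))
      = δ * T * ((w₀ * a + N 0 1 * b) ^ 2 + (N 1 0 * a + w₃ * b) ^ 2) := by
    intro a b
    apply mul_left_cancel₀ htr.ne'
    have h := hlyap (w₀ * a + N 0 1 * b) (N 1 0 * a + w₃ * b)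
    rw [ch₀, ch₁] at h
    linear_combination h
  refine ⟨Q.transpose * !![Y₀, Y₁; Y₁, Y₃] * !![w₀, N 0 1; N 1 0, w₃],
    min (δ * T * T * k) (δ * T * k'), by positivity, fun x₁ x₂ y₁ y₂ => ?_⟩
  have hx := mul_le_mul_of_nonneg_left (hkQ x₁ x₂) (by positivity : 0 ≤ δ * T * T)
  have hy := mul_le_mul_of_nonneg_left (hkW y₁ y₂) hW0.le
  have hx' := mul_le_mul_of_nonneg_right (min_le_left (δ * T * T * k) (δ * T * k'))
    (by positivity : 0 ≤ x₁ ^ 2 + x₂ ^ 2)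
  have hy' := mul_le_mul_of_nonneg_right (min_le_right (δ * T * T * k) (δ * T * k'))
    (by positivity : 0 ≤ y₁ ^ 2 + y₂ ^ 2)
  rw [← hlyap] at hx
  rw [← hη] at hy
  simp only [Matrix.mul_apply, Fin.sum_univ_two, Matrix.transpose_apply, Matrix.of_apply,
    Matrix.cons_val_zero, Matrix.cons_val_one]
  generalize min (δ * T * T * k) (δ * T * k') = c at *
  have : c * (x₁ ^ 2 + x₂ ^ 2 + y₁ ^ 2 + y₂ ^ 2)
    = c * (x₁ ^ 2 + x₂ ^ 2) + c * (y₁ ^ 2 + y₂ ^ 2) := by ring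
  rw [this]
  rw [← mul_assoc] at hx hy
  refine (add_le_add (hx'.trans hx) (hy'.trans hy)).trans (le_of_eq ?_)
  linear_combination (Y₀ * (w₀ * y₁ + N 0 1 * y₂) + Y₁ * (N 1 0 * y₁ + w₃ * y₂))
      * (y₁ * n00 + y₂ * n01)
    + (Y₁ * (w₀ * y₁ + N 0 1 * y₂) + Y₃ * (N 1 0 * y₁ + w₃ * y₂)) * (y₁ * n10 + y₂ * n11)

/-! ### Trace and determinant of the transverse system -/

/-- The coefficient of `-x²/(λ₂+λ₃)²` in the trace of `Q(x, y) P(x, y)`. -/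
noncomputable def traceCoeffX (l : Fin 4 → ℝ) : ℝ :=
  (l 0 - l 2) * (l 0 - l 1) / ((l 0 + l 1) * (l 0 + l 2))
    + (l 1 - l 3) * (l 2 - l 3) / ((l 2 + l 3) * (l 1 + l 3))

/-- The coefficient of `y²/(λ₁+λ₄)²` in the trace of `Q(x, y) P(x, y)`. -/
noncomputable def traceCoeffY (l : Fin 4 → ℝ) : ℝ :=
  (l 0 - l 2) * (l 2 - l 3) / ((l 2 + l 3) * (l 0 + l 2))
    + (l 0 - l 1) * (l 1 - l 3) / ((l 1 + l 3) * (l 0 + l 1))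

/-- The coefficient of `y²/(λ₁+λ₄)² - x²/(λ₂+λ₃)²` in the square root of the determinant of
`Q(x, y) P(x, y)`. -/
noncomputable def detCoeff (l : Fin 4 → ℝ) : ℝ :=
  √((l 0 ^ 2 - l 2 ^ 2) * (l 1 ^ 2 - l 3 ^ 2)) * √((l 0 ^ 2 - l 1 ^ 2) * (l 2 ^ 2 - l 3 ^ 2))
    / ((l 0 + l 1) * (l 2 + l 3) * (l 0 + l 2) * (l 1 + l 3))

section
variable {l : Fin 4 → ℝ} (hpos : ∀ i j, i ≠ j → 0 < l i + l j)
include hpos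

theorem trace_transverse (s t : ℝ) : (transverseQ l s t * transverseP l s t).trace
    = traceCoeffY l * (t / (l 0 + l 3)) ^ 2 - traceCoeffX l * (s / (l 1 + l 2)) ^ 2 := by
  have h01 := (hpos 0 1 (by decide)).ne'
  have h02 := (hpos 0 2 (by decide)).ne'
  have h03 := (hpos 0 3 (by decide)).ne'
  have h12 := (hpos 1 2 (by decide)).ne'
  have h13 := (hpos 1 3 (by decide)).ne'
  have h23 := (hpos 2 3 (by decide)).ne'
  rw [Matrix.trace_fin_two, traceCoeffX, traceCoeffY]
  simp only [Matrix.mul_apply, Fin.sum_univ_two, transverseP, transverseQ]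
  simp
  field_simp
  ring

theorem det_transverse (hu : StrictAnti fun i => l i ^ 2) (s t : ℝ) :
    (transverseQ l s t * transverseP l s t).det
      = (detCoeff l * ((t / (l 0 + l 3)) ^ 2 - (s / (l 1 + l 2)) ^ 2)) ^ 2 := by
  have h01 := (hpos 0 1 (by decide)).ne'
  have h02 := (hpos 0 2 (by decide)).ne'
  have h03 := (hpos 0 3 (by decide)).ne'
  have h12 := (hpos 1 2 (by decide)).ne'
  have h13 := (hpos 1 3 (by decide)).ne'
  have h23 := (hpos 2 3 (by decide)).ne'
  have u01 : l 1 ^ 2 < l 0 ^ 2 := hu (show (0 : Fin 4) < 1 by decide)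
  have u12 : l 2 ^ 2 < l 1 ^ 2 := hu (show (1 : Fin 4) < 2 by decide)
  have u23 : l 3 ^ 2 < l 2 ^ 2 := hu (show (2 : Fin 4) < 3 by decide)
  rw [detCoeff, mul_pow, div_pow, mul_pow,
    Real.sq_sqrt (mul_nonneg (by linarith) (by linarith)),
    Real.sq_sqrt (mul_nonneg (by linarith) (by linarith)), Matrix.det_mul, Matrix.det_fin_two,
    Matrix.det_fin_two]
  simp [transverseP, transverseQ]
  field_simp
  ring

/-- The upper root `α₂` is the value of `x²/y²` where `tr(Q P)` equals minus twice the square root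
of the determinant. -/
theorem bifurcationRoot₂_mul (hu : StrictAnti fun i => l i ^ 2) :
    bifurcationRoot₂ l * ((traceCoeffX l + 2 * detCoeff l) / (l 1 + l 2) ^ 2)
      = (traceCoeffY l + 2 * detCoeff l) / (l 0 + l 3) ^ 2 := by
  have h01 := (hpos 0 1 (by decide)).ne'
  have h02 := (hpos 0 2 (by decide)).ne'
  have h03 := (hpos 0 3 (by decide)).ne'
  have h12 := (hpos 1 2 (by decide)).ne'
  have h13 := (hpos 1 3 (by decide)).ne'
  have h23 := (hpos 2 3 (by decide)).ne'
  have u01 : l 1 ^ 2 < l 0 ^ 2 := hu (show (0 : Fin 4) < 1 by decide)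
  have u12 : l 2 ^ 2 < l 1 ^ 2 := hu (show (1 : Fin 4) < 2 by decide)
  have u23 : l 3 ^ 2 < l 2 ^ 2 := hu (show (2 : Fin 4) < 3 by decide)
  have hq := Real.sq_sqrt (mul_nonneg (by linarith : 0 ≤ l 0 ^ 2 - l 2 ^ 2)
    (by linarith : 0 ≤ l 1 ^ 2 - l 3 ^ 2))
  have hp := Real.sq_sqrt (mul_nonneg (by linarith : 0 ≤ l 0 ^ 2 - l 1 ^ 2)
    (by linarith : 0 ≤ l 2 ^ 2 - l 3 ^ 2))
  rw [bifurcationRoot₂, traceCoeffX, traceCoeffY, detCoeff]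
  generalize √((l 0 ^ 2 - l 2 ^ 2) * (l 1 ^ 2 - l 3 ^ 2)) = q at *
  generalize √((l 0 ^ 2 - l 1 ^ 2) * (l 2 ^ 2 - l 3 ^ 2)) = p at *
  have hU : l 0 - l 3 ≠ 0 := by
    intro h
    have : l 0 = l 3 := by linarith
    rw [this] at u01
    linarith
  have hUe : l 0 ^ 2 - l 3 ^ 2 = (l 0 - l 3) * (l 0 + l 3) := by ring
  rw [hUe]
  have hτ : (l 0 - l 2) * (l 0 - l 1) / ((l 0 + l 1) * (l 0 + l 2))
      + (l 1 - l 3) * (l 2 - l 3) / ((l 2 + l 3) * (l 1 + l 3))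
      + 2 * (q * p / ((l 0 + l 1) * (l 2 + l 3) * (l 0 + l 2) * (l 1 + l 3)))
      = ((l 0 - l 2) * (l 0 - l 1) * ((l 2 + l 3) * (l 1 + l 3))
        + (l 1 - l 3) * (l 2 - l 3) * ((l 0 + l 1) * (l 0 + l 2)) + 2 * (q * p))
        / ((l 0 + l 1) * (l 2 + l 3) * (l 0 + l 2) * (l 1 + l 3)) := by
    field_simp
  have hτ' : (l 0 - l 2) * (l 2 - l 3) / ((l 2 + l 3) * (l 0 + l 2))
      + (l 0 - l 1) * (l 1 - l 3) / ((l 1 + l 3) * (l 0 + l 1))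
      + 2 * (q * p / ((l 0 + l 1) * (l 2 + l 3) * (l 0 + l 2) * (l 1 + l 3)))
      = ((l 0 - l 2) * (l 2 - l 3) * ((l 1 + l 3) * (l 0 + l 1))
        + (l 0 - l 1) * (l 1 - l 3) * ((l 2 + l 3) * (l 0 + l 2)) + 2 * (q * p))
        / ((l 0 + l 1) * (l 2 + l 3) * (l 0 + l 2) * (l 1 + l 3)) := by
    field_simp
  rw [hτ, hτ', div_pow, mul_pow, div_div, div_div, div_mul_div_comm,
    div_eq_div_iff (by positivity) (by positivity)]
  obtain ⟨τ, hτe⟩ : ∃ τ, τ = (l 0 - l 2) * (l 0 - l 1) * ((l 2 + l 3) * (l 1 + l 3))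
        + (l 1 - l 3) * (l 2 - l 3) * ((l 0 + l 1) * (l 0 + l 2)) := ⟨_, rfl⟩
  obtain ⟨τ', hτe'⟩ : ∃ τ, τ = (l 0 - l 2) * (l 2 - l 3) * ((l 1 + l 3) * (l 0 + l 1))
        + (l 0 - l 1) * (l 1 - l 3) * ((l 2 + l 3) * (l 0 + l 2)) := ⟨_, rfl⟩
  rw [← hτe, ← hτe']
  have key : (q + p) ^ 2 * (τ + 2 * (q * p))
      = (l 1 + l 2) ^ 2 * (l 0 - l 3) ^ 2 * (τ' + 2 * (q * p)) := by
    have k1 : q ^ 2 + p ^ 2 + τ = (l 1 + l 2) ^ 2 * (l 0 - l 3) ^ 2 := by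
      rw [hq, hp, hτe]; ring
    have k2 : (q ^ 2 + p ^ 2) * τ + 4 * (q ^ 2 * p ^ 2)
        = (l 1 + l 2) ^ 2 * (l 0 - l 3) ^ 2 * τ' := by
      rw [hq, hp, hτe, hτe']; ring
    linear_combination k2 + 2 * (q * p) * k1
  linear_combination (l 0 + l 3) ^ 2 * ((l 0 + l 1) * (l 2 + l 3) * (l 0 + l 2) * (l 1 + l 3)) * key

theorem traceCoeffY_le_traceCoeffX : traceCoeffY l ≤ traceCoeffX l := by
  have h01 := hpos 0 1 (by decide)
  have h02 := hpos 0 2 (by decide)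
  have h13 := hpos 1 3 (by decide)
  have h23 := hpos 2 3 (by decide)
  have : traceCoeffX l - traceCoeffY l = (2 * (l 0 * l 3 - l 1 * l 2)) ^ 2
      / ((l 0 + l 1) * (l 2 + l 3) * (l 0 + l 2) * (l 1 + l 3)) := by
    rw [traceCoeffX, traceCoeffY]
    field_simp
    ring
  have h : 0 ≤ traceCoeffX l - traceCoeffY l := by rw [this]; positivity
  linarith

/-- `δ` is the square root of `det(Q P)` that is nonnegative for ratios up to `α₂`. -/
theorem transverse_hyperbolic_or_double_root (hl : StrictAnti l)
    (hu : StrictAnti fun i => l i ^ 2) {s t : ℝ} (ht : t ≠ 0) :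
    ∃ δ, (transverseQ l s t * transverseP l s t).det = δ ^ 2 ∧
      (s ^ 2 / t ^ 2 < bifurcationRoot₂ l →
        0 < δ ∧ 0 < (transverseQ l s t * transverseP l s t).trace + 2 * δ) ∧
      (s ^ 2 / t ^ 2 = bifurcationRoot₂ l →
        0 ≤ δ ∧ (transverseQ l s t * transverseP l s t).trace = -2 * δ) := by
  have h01 := hpos 0 1 (by decide)
  have h02 := hpos 0 2 (by decide)
  have h03 := hpos 0 3 (by decide)
  have h12 := hpos 1 2 (by decide)
  have h13 := hpos 1 3 (by decide)
  have h23 := hpos 2 3 (by decide)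
  have u01 : l 1 ^ 2 < l 0 ^ 2 := hu (show (0 : Fin 4) < 1 by decide)
  have u12 : l 2 ^ 2 < l 1 ^ 2 := hu (show (1 : Fin 4) < 2 by decide)
  have u23 : l 3 ^ 2 < l 2 ^ 2 := hu (show (2 : Fin 4) < 3 by decide)
  have g01 : 0 < l 0 - l 1 := sub_pos.2 (hl (show (0 : Fin 4) < 1 by decide))
  have g02 : 0 < l 0 - l 2 := sub_pos.2 (hl (show (0 : Fin 4) < 2 by decide))
  have g13 : 0 < l 1 - l 3 := sub_pos.2 (hl (show (1 : Fin 4) < 3 by decide))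
  have g23 : 0 < l 2 - l 3 := sub_pos.2 (hl (show (2 : Fin 4) < 3 by decide))
  have hκ : 0 < detCoeff l := by
    have := Real.sqrt_pos.2 (mul_pos (by linarith : 0 < l 0 ^ 2 - l 2 ^ 2)
      (by linarith : 0 < l 1 ^ 2 - l 3 ^ 2))
    have := Real.sqrt_pos.2 (mul_pos (by linarith : 0 < l 0 ^ 2 - l 1 ^ 2)
      (by linarith : 0 < l 2 ^ 2 - l 3 ^ 2))
    rw [detCoeff]
    positivity
  have hT2 : 0 < traceCoeffY l := by rw [traceCoeffY]; positivity
  have hT := traceCoeffY_le_traceCoeffX hpos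
  have hroot := bifurcationRoot₂_mul hpos hu
  refine ⟨_, det_transverse hpos hu s t, ?_⟩
  rw [trace_transverse hpos]
  have ht2 : 0 < t ^ 2 := by positivity
  obtain ⟨r, hr⟩ : ∃ r, r = s ^ 2 / t ^ 2 := ⟨_, rfl⟩
  have hs : s ^ 2 = r * t ^ 2 := by rw [hr]; field_simp
  rw [← hr]
  rw [div_pow, div_pow, hs]
  generalize detCoeff l = κ at *
  generalize traceCoeffX l = T₁ at *
  generalize traceCoeffY l = T₂ at *
  generalize bifurcationRoot₂ l = α at *
  have hT1 : 0 < T₁ + 2 * κ := by linarith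
  have hαβ : α * (1 / (l 1 + l 2) ^ 2) ≤ 1 / (l 0 + l 3) ^ 2 := by
    refine le_of_mul_le_mul_right ?_ hT1
    have e : α * (1 / (l 1 + l 2) ^ 2) * (T₁ + 2 * κ) = (T₂ + 2 * κ) / (l 0 + l 3) ^ 2 := by
      rw [← hroot]; ring
    rw [e, div_mul_eq_mul_div, one_mul]
    gcongr
  have etr : T₂ * (t ^ 2 / (l 0 + l 3) ^ 2) - T₁ * (r * t ^ 2 / (l 1 + l 2) ^ 2)
      + 2 * (κ * (t ^ 2 / (l 0 + l 3) ^ 2 - r * t ^ 2 / (l 1 + l 2) ^ 2))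
      = t ^ 2 * ((α - r) * ((T₁ + 2 * κ) / (l 1 + l 2) ^ 2)) := by
    linear_combination -t ^ 2 * hroot
  have eδ : t ^ 2 / (l 0 + l 3) ^ 2 - r * t ^ 2 / (l 1 + l 2) ^ 2
      = t ^ 2 * (1 / (l 0 + l 3) ^ 2 - r * (1 / (l 1 + l 2) ^ 2)) := by ring
  constructor
  · intro hrα
    constructor
    · rw [eδ]
      have : r * (1 / (l 1 + l 2) ^ 2) < α * (1 / (l 1 + l 2) ^ 2) := by gcongr
      exact mul_pos hκ (mul_pos ht2 (by linarith))
    · rw [etr]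
      have := sub_pos.2 hrα
      positivity
  · intro hrα
    constructor
    · rw [eδ, hrα]
      exact mul_nonneg hκ.le (mul_nonneg ht2.le (by linarith))
    · rw [hrα, sub_self, zero_mul, mul_zero] at etr
      rw [hrα]
      linarith

end

/-! ### Instability -/

open scoped RealInnerProductSpace in
/-- The field is tangent to the spheres since `C₁` is conserved. -/
theorem inner_rigidBodyField {l : Fin 4 → ℝ} (hpos : ∀ i j, i ≠ j → 0 < l i + l j) (N : So4) :
    ⟪N, rigidBodyField l N⟫ = 0 := by
  have h := fderiv_energyFunction_rigidBodyField hpos 0 0 1 0 N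
  rw [fderiv_energyFunction, pairedBilin_apply] at h
  simp [energyCoeff] at h
  simp [PiLp.inner_apply, Fin.sum_univ_succ]
  linear_combination h

theorem abs_mul_mul_mul_le {p r y z A B ρ : ℝ} (hp : |p| ≤ A) (hr : |r| ≤ B) (hy : y ^ 2 ≤ ρ)
    (hz : z ^ 2 ≤ ρ) : |p * y * (r * z)| ≤ A * B * ρ := by
  have h1 : |y * z| ≤ ρ := by
    rw [abs_le]
    constructor
    · linarith [sq_nonneg (y + z)]
    · linarith [sq_nonneg (y - z)]
  have h2 : |p * y * (r * z)| = |p| * |r| * |y * z| := by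
    rw [← abs_mul, ← abs_mul]; congr 1; ring
  rw [h2]
  have hA := (abs_nonneg p).trans hp
  have hB := (abs_nonneg r).trans hr
  exact mul_le_mul (mul_le_mul hp hr (abs_nonneg r) hA) h1 (abs_nonneg _) (mul_nonneg hA hB)

/-- The bilinear form with matrix `R` between `(x₂, y₂)` and `(x₃, y₃)`, as a function on
`so(4)`. -/
def transverseForm (R : Matrix (Fin 2) (Fin 2) ℝ) (N : So4) : ℝ :=
  N 1 * (R 0 0 * N 2 + R 0 1 * N 5) + N 4 * (R 1 0 * N 2 + R 1 1 * N 5)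

theorem hasFDerivAt_transverseForm (R : Matrix (Fin 2) (Fin 2) ℝ) (N : So4) :
    ∃ L : So4 →L[ℝ] ℝ, HasFDerivAt (transverseForm R) L N ∧ ∀ v : So4,
      L v = v 1 * (R 0 0 * N 2 + R 0 1 * N 5) + v 4 * (R 1 0 * N 2 + R 1 1 * N 5)
        + (N 1 * (R 0 0 * v 2 + R 0 1 * v 5) + N 4 * (R 1 0 * v 2 + R 1 1 * v 5)) := by
  have hp : ∀ i, HasFDerivAt (fun N : So4 => N i) (EuclideanSpace.proj i : So4 →L[ℝ] ℝ) N :=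
    fun i => (EuclideanSpace.proj i : So4 →L[ℝ] ℝ).hasFDerivAt
  refine ⟨_, ((hp 1).mul (((hp 2).const_mul (R 0 0)).add ((hp 5).const_mul (R 0 1)))).add
    ((hp 4).mul (((hp 2).const_mul (R 1 0)).add ((hp 5).const_mul (R 1 1)))), fun v => ?_⟩
  simp
  ring

/-- A bilinear form that increases along the linearization is a Chetaev function near the
equilibrium, since the transverse equations are linear in the transverse coordinates. -/
theorem exists_chetaev_neighborhood {l : Fin 4 → ℝ} {s t c : ℝ} {R : Matrix (Fin 2) (Fin 2) ℝ}
    (hc : 0 < c)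
    (hR : ∀ x₁ x₂ y₁ y₂ : ℝ, c * (x₁ ^ 2 + x₂ ^ 2 + y₁ ^ 2 + y₂ ^ 2) ≤
        (transverseP l s t 0 0 * y₁ + transverseP l s t 0 1 * y₂) * (R 0 0 * y₁ + R 0 1 * y₂)
          + (transverseP l s t 1 0 * y₁ + transverseP l s t 1 1 * y₂) * (R 1 0 * y₁ + R 1 1 * y₂)
          + (x₁ * (R 0 0 * (transverseQ l s t 0 0 * x₁ + transverseQ l s t 0 1 * x₂)
              + R 0 1 * (transverseQ l s t 1 0 * x₁ + transverseQ l s t 1 1 * x₂))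
            + x₂ * (R 1 0 * (transverseQ l s t 0 0 * x₁ + transverseQ l s t 0 1 * x₂)
              + R 1 1 * (transverseQ l s t 1 0 * x₁ + transverseQ l s t 1 1 * x₂)))) :
    ∃ ε > 0, ∃ k > 0, ∃ B, ∀ N, dist N (equilibrium₁ s t) < ε →
      k * transverseForm R N ≤ fderiv ℝ (transverseForm R) N (rigidBodyField l N) ∧
        transverseForm R N ≤ B := by
  obtain ⟨B, hB⟩ : ∃ B, B = |R 0 0| + |R 0 1| + |R 1 0| + |R 1 1| + 1 := ⟨_, rfl⟩
  have a00 := abs_nonneg (R 0 0)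
  have a01 := abs_nonneg (R 0 1)
  have a10 := abs_nonneg (R 1 0)
  have a11 := abs_nonneg (R 1 1)
  have b00 : |R 0 0| ≤ B := by linarith
  have b01 : |R 0 1| ≤ B := by linarith
  have b10 : |R 1 0| ≤ B := by linarith
  have b11 : |R 1 1| ≤ B := by linarith
  have hB0 : 0 < B := by linarith
  -- Near the equilibrium the coefficients are so close to their limits that the form still grows
  -- at least half as fast.
  have hη : 0 < c / (32 * B) := by positivity
  have hcP : ∀ i j, Continuous fun N : So4 => transverseP l (N 0) (N 3) i j := fun i j => by
    fin_cases i <;> fin_cases j <;> simp [transverseP] <;> fun_prop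
  have hcQ : ∀ i j, Continuous fun N : So4 => transverseQ l (N 0) (N 3) i j := fun i j => by
    fin_cases i <;> fin_cases j <;> simp [transverseQ] <;> fun_prop
  have hev : ∀ᶠ N in nhds (equilibrium₁ s t), ∀ i j : Fin 2,
      |transverseP l (N 0) (N 3) i j - transverseP l s t i j| < c / (32 * B) ∧
      |transverseQ l (N 0) (N 3) i j - transverseQ l s t i j| < c / (32 * B) := by
    refine Filter.eventually_all.2 fun i => Filter.eventually_all.2 fun j => ?_
    have h1 := Metric.tendsto_nhds.1 ((hcP i j).tendsto (equilibrium₁ s t)) _ hη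
    have h2 := Metric.tendsto_nhds.1 ((hcQ i j).tendsto (equilibrium₁ s t)) _ hη
    filter_upwards [h1, h2] with N g1 g2
    exact ⟨g1, g2⟩
  obtain ⟨ε, hε, hball⟩ := Metric.eventually_nhds_iff.1 hev
  refine ⟨min ε 1, by positivity, c / (8 * B), by positivity, 4 * B, fun N hN => ?_⟩
  have hd := hball (hN.trans_le (min_le_left _ _))
  obtain ⟨ρ, hρ⟩ : ∃ ρ, ρ = N 1 ^ 2 + N 4 ^ 2 + N 2 ^ 2 + N 5 ^ 2 := ⟨_, rfl⟩
  have r1 : N 1 ^ 2 ≤ ρ := by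
    rw [hρ]; linarith [sq_nonneg (N 4), sq_nonneg (N 2), sq_nonneg (N 5)]
  have r4 : N 4 ^ 2 ≤ ρ := by
    rw [hρ]; linarith [sq_nonneg (N 1), sq_nonneg (N 2), sq_nonneg (N 5)]
  have r2 : N 2 ^ 2 ≤ ρ := by
    rw [hρ]; linarith [sq_nonneg (N 4), sq_nonneg (N 1), sq_nonneg (N 5)]
  have r5 : N 5 ^ 2 ≤ ρ := by
    rw [hρ]; linarith [sq_nonneg (N 4), sq_nonneg (N 2), sq_nonneg (N 1)]
  have hρ0 : 0 ≤ ρ := (sq_nonneg _).trans r1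
  have hρ1 : ρ ≤ 1 := by
    have h1 : dist N (equilibrium₁ s t) ^ 2 ≤ 1 :=
      pow_le_one₀ dist_nonneg (hN.trans_le (min_le_right _ _)).le
    rw [so4_dist_sq] at h1
    simp [equilibrium₁] at h1
    linarith [sq_nonneg (N 0 - s), sq_nonneg (N 3 - t)]
  have hV : transverseForm R N ≤ 4 * B * ρ := by
    have one : |(1 : ℝ)| ≤ 1 := by simp
    have h1 := (le_abs_self _).trans (abs_mul_mul_mul_le one b00 r1 r2)
    have h2 := (le_abs_self _).trans (abs_mul_mul_mul_le one b01 r1 r5)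
    have h3 := (le_abs_self _).trans (abs_mul_mul_mul_le one b10 r4 r2)
    have h4 := (le_abs_self _).trans (abs_mul_mul_mul_le one b11 r4 r5)
    rw [transverseForm]
    linarith
  constructor
  · obtain ⟨L, hL, hLv⟩ := hasFDerivAt_transverseForm R N
    obtain ⟨f1, f4, f2, f5⟩ := rigidBodyField_transverse l N
    rw [hL.fderiv, hLv, f1, f4, f2, f5]
    have hmain := hR (N 1) (N 4) (N 2) (N 5)
    rw [← hρ] at hmain
    have hkV : c / (8 * B) * transverseForm R N ≤ c / 2 * ρ := by
      refine (mul_le_mul_of_nonneg_left hV (by positivity)).trans (le_of_eq ?_)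
      field_simp
      ring
    have hηB : c / (32 * B) * B * ρ = c / 32 * ρ := by field_simp
    have low : ∀ {p r y z : ℝ}, |p| ≤ c / (32 * B) → |r| ≤ B → y ^ 2 ≤ ρ → z ^ 2 ≤ ρ →
        -(c / 32 * ρ) ≤ p * y * (r * z) := fun hp hr hy hz => by
      have := (abs_le.1 (abs_mul_mul_mul_le hp hr hy hz)).1
      rwa [hηB] at this
    have p00 := (hd 0 0).1.le
    have p01 := (hd 0 1).1.le
    have p10 := (hd 1 0).1.le
    have p11 := (hd 1 1).1.le
    have q00 := (hd 0 0).2.le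
    have q01 := (hd 0 1).2.le
    have q10 := (hd 1 0).2.le
    have q11 := (hd 1 1).2.le
    linarith [low p00 b00 r2 r2, low p00 b01 r2 r5, low p01 b00 r5 r2, low p01 b01 r5 r5,
      low p10 b10 r2 r2, low p10 b11 r2 r5, low p11 b10 r5 r2, low p11 b11 r5 r5,
      low q00 b00 r1 r1, low q01 b00 r4 r1, low q10 b01 r1 r1, low q11 b01 r4 r1,
      low q00 b10 r1 r4, low q01 b10 r4 r4, low q10 b11 r1 r4, low q11 b11 r4 r4]
  · exact hV.trans (mul_le_of_le_one_right (by positivity) hρ1)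

/-- From the equilibrium a curve in the orbit leaves in every transverse direction `u`. It is
explicit since the orbit is a product of two spheres in the coordinates `xᵢ ± yᵢ`. -/
theorem exists_orbit_point_near {c₁ c₂ a b σ : ℝ} (hσ : σ ^ 2 = 1) (ha : 0 < a)
    (hba : b ^ 2 < a ^ 2) (h1 : a ^ 2 + b ^ 2 = 2 * c₁) (h2 : a * b = c₂) (u₁ u₂ u₄ u₅ : ℝ)
    {δ : ℝ} (hδ : 0 < δ) :
    ∃ N ∈ orbit c₁ c₂, dist N (equilibrium₁ (σ * b) (σ * a)) < δ ∧
      ∃ r > 0, N 1 = r * u₁ ∧ N 2 = r * u₂ ∧ N 4 = r * u₄ ∧ N 5 = r * u₅ := by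
  obtain ⟨hlo, hhi⟩ := abs_lt_of_sq_lt_sq' hba ha.le
  let f : ℝ → ℝ := fun r => (a + b) ^ 2 - r ^ 2 * ((u₁ + u₄) ^ 2 + (u₂ + u₅) ^ 2)
  let g : ℝ → ℝ := fun r => (a - b) ^ 2 - r ^ 2 * ((u₁ - u₄) ^ 2 + (u₂ - u₅) ^ 2)
  let φ : ℝ → So4 := fun r => !₂[σ * ((√(f r) - √(g r)) / 2), r * u₁, r * u₂,
    σ * ((√(f r) + √(g r)) / 2), r * u₄, r * u₅]
  have hfc : Continuous f := by fun_prop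
  have hgc : Continuous g := by fun_prop
  have hφc : Continuous φ := by
    refine (PiLp.continuous_toLp 2 _).comp (continuous_pi fun i => ?_)
    fin_cases i <;> simp <;> fun_prop
  have hφ0 : φ 0 = equilibrium₁ (σ * b) (σ * a) := by
    have e1 : √((a + b) ^ 2) = a + b := Real.sqrt_sq (by linarith)
    have e2 : √((a - b) ^ 2) = a - b := Real.sqrt_sq (by linarith)
    ext i
    fin_cases i <;> simp [φ, f, g, equilibrium₁, e1, e2]
  have ev1 : ∀ᶠ r in nhds (0 : ℝ), 0 < f r :=
    continuousAt_const.eventually_lt hfc.continuousAt (by simp [f]; nlinarith)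
  have ev2 : ∀ᶠ r in nhds (0 : ℝ), 0 < g r :=
    continuousAt_const.eventually_lt hgc.continuousAt (by simp [g]; nlinarith)
  have ev3 : ∀ᶠ r in nhds (0 : ℝ), dist (φ r) (equilibrium₁ (σ * b) (σ * a)) < δ := by
    have := Metric.tendsto_nhds.1 (hφc.tendsto 0) δ hδ
    rwa [hφ0] at this
  have ev : ∀ᶠ r in nhdsWithin (0 : ℝ) (Set.Ioi 0), 0 < r ∧ 0 < f r ∧ 0 < g r ∧
      dist (φ r) (equilibrium₁ (σ * b) (σ * a)) < δ := by
    filter_upwards [self_mem_nhdsWithin, nhdsWithin_le_nhds ev1, nhdsWithin_le_nhds ev2,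
      nhdsWithin_le_nhds ev3] with r i1 i2 i3 i4 using ⟨i1, i2, i3, i4⟩
  obtain ⟨r, hr, hf, hg, hd⟩ := ev.exists
  have sf := Real.sq_sqrt hf.le
  have sg := Real.sq_sqrt hg.le
  refine ⟨φ r, ⟨?_, ?_⟩, hd, r, hr, rfl, rfl, rfl, rfl⟩
  · simp only [φ, casimir₁]
    simp
    generalize √(f r) = x at *
    generalize √(g r) = y at *
    simp only [f, g] at sf sg
    linear_combination 1 / 4 * (sf + sg) + 1 / 4 * (x ^ 2 + y ^ 2) * hσ + 1 / 2 * h1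
  · simp only [φ, casimir₂]
    simp
    generalize √(f r) = x at *
    generalize √(g r) = y at *
    simp only [f, g] at sf sg
    linear_combination 1 / 4 * (sf - sg) + 1 / 4 * (x ^ 2 - y ^ 2) * hσ + h2

theorem not_isNonlinearlyStableOn_of_hyperbolic {l : Fin 4 → ℝ}
    (hpos : ∀ i j, i ≠ j → 0 < l i + l j) {c₁ c₂ a b σ δ : ℝ} (hσ : σ ^ 2 = 1) (ha : 0 < a)
    (hba : b ^ 2 < a ^ 2) (h1 : a ^ 2 + b ^ 2 = 2 * c₁) (h2 : a * b = c₂) (hδ : 0 < δ)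
    (hdet : (transverseQ l (σ * b) (σ * a) * transverseP l (σ * b) (σ * a)).det = δ ^ 2)
    (htr : 0 < (transverseQ l (σ * b) (σ * a) * transverseP l (σ * b) (σ * a)).trace + 2 * δ) :
    ¬ IsNonlinearlyStableOn (rigidBodyField l) (orbit c₁ c₂) (equilibrium₁ (σ * b) (σ * a)) := by
  obtain ⟨R, c, hc, hR⟩ := exists_increasing_form hδ hdet htr
  obtain ⟨ε, hε, k, hk, B, hball⟩ := exists_chetaev_neighborhood hc hR
  intro hstab
  obtain ⟨δ', hδ', hstab⟩ := hstab ε hε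
  -- The form is positive on `(ξ, η) = (e₁, Q e₁)`.
  obtain ⟨N, hN, hNd, r, hr, e1, e2, e4, e5⟩ := exists_orbit_point_near hσ ha hba h1 h2 1
    (transverseQ l (σ * b) (σ * a) 0 0) 0 (transverseQ l (σ * b) (σ * a) 1 0) hδ'
  have hVN : 0 < transverseForm R N := by
    have h := hR 1 0 0 0
    have hr2 := mul_pos (mul_pos hr hr) hc
    have := mul_le_mul_of_nonneg_left h (mul_pos hr hr).le
    rw [transverseForm, e1, e2, e4, e5]
    linarith
  obtain ⟨γ, h0, hγ⟩ := exists_isIntegralCurve_of_inner_eq_zero (contDiff_rigidBodyField l)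
    (inner_rigidBodyField hpos) N
  obtain ⟨τ, hτ, hfar⟩ := exists_le_dist_of_chetaev
    (fun N => (hasFDerivAt_transverseForm R N).choose_spec.1.differentiableAt) hk
    (fun N hN => (hball N hN).1) (fun N hN => (hball N hN).2) hγ (h0 ▸ hVN)
  exact absurd (hstab γ (hγ.isIntegralCurveOn _) (h0 ▸ hN) (h0 ▸ hNd) τ hτ) (not_lt.2 hfar)

theorem equilibrium₁_mem_orbit {c₁ c₂ a b σ : ℝ} (hσ : σ ^ 2 = 1)
    (h1 : a ^ 2 + b ^ 2 = 2 * c₁) (h2 : a * b = c₂) :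
    equilibrium₁ (σ * b) (σ * a) ∈ orbit c₁ c₂ := by
  constructor
  · simp [equilibrium₁, casimir₁]
    linear_combination 1 / 2 * (a ^ 2 + b ^ 2) * hσ + 1 / 2 * h1
  · simp [equilibrium₁, casimir₂]
    linear_combination a * b * hσ + h2

theorem eq_equilibrium₁_of_mem {a b : ℝ} {M : So4}
    (hM : M ∈ ({equilibrium₁ b a, equilibrium₁ (-b) (-a)} : Set So4)) :
    ∃ σ : ℝ, σ ^ 2 = 1 ∧ M = equilibrium₁ (σ * b) (σ * a) := by
  rcases hM with h | h
  · exact ⟨1, by norm_num, by rw [h, one_mul, one_mul]⟩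
  · exact ⟨-1, by norm_num, by rw [h, neg_one_mul, neg_one_mul]⟩

end SO4RigidBody

theorem mainTheorem3 (l : Fin 4 → ℝ) (hl : StrictAnti l)
    (hpos : ∀ i j, i ≠ j → 0 < l i + l j) :
    ∃ α₁ α₂ : ℝ, α₁ < α₂ ∧ (∀ t, bifurcationQuadratic l t = 0 ↔ t = α₁ ∨ t = α₂) ∧
      ∀ c₁ c₂ a b : ℝ, 0 < c₁ → |c₂| < c₁ → a = orbitA c₁ c₂ → b = orbitB c₁ c₂ →
        -- (i)
        (b ^ 2 / a ^ 2 ∈ Set.Ioo α₂ 1 →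
          ∃ p₃ p₄ : ℝ, p₃ < p₄ ∧
            (∀ p, lyapunovQuadratic l a b p = 0 ↔ p = p₃ ∨ p = p₄) ∧
            (∀ p, lyapunovQuadratic l a b p < 0 ↔ p ∈ Set.Ioo p₃ p₄) ∧
            ∀ M ∈ ({equilibrium₁ b a, equilibrium₁ (-b) (-a)} : Set So4),
              M ∈ orbit c₁ c₂ ∧ rigidBodyField l M = 0 ∧
              IsNonlinearlyStableOn (rigidBodyField l) (orbit c₁ c₂) M ∧
              IsNonlinearlyStableOn (rigidBodyField l) Set.univ M ∧
              ∀ p ∈ Set.Ioo p₃ p₄,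
                (∃ m n : ℝ, fderiv ℝ (lyapunovCandidate l p m n) M = 0) ∧
                ∀ m n : ℝ, fderiv ℝ (lyapunovCandidate l p m n) M = 0 →
                  HessianPosDefOn (lyapunovCandidate l p m n) M (casimirKernel M) ∧
                  IsLyapunovFunctionOn (lyapunovCandidate l p m n) (rigidBodyField l)
                    (orbit c₁ c₂) M) ∧
        -- (ii)
        (b ^ 2 / a ^ 2 = α₂ →
          ∀ M ∈ ({equilibrium₁ b a, equilibrium₁ (-b) (-a)} : Set So4),
            M ∈ orbit c₁ c₂ ∧ rigidBodyField l M = 0 ∧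
            IsSpectrallyStable (rigidBodyField l) M ∧
            ∀ μ₁ μ₂ m n : ℝ, fderiv ℝ (energyFunction l μ₁ μ₂ m n) M = 0 →
              ¬ HessianPosDefOn (energyFunction l μ₁ μ₂ m n) M (casimirKernel M) ∧
              ¬ HessianNegDefOn (energyFunction l μ₁ μ₂ m n) M (casimirKernel M)) ∧
        -- (iii)
        (b ^ 2 / a ^ 2 ∈ Set.Ico 0 α₂ →
          ∀ M ∈ ({equilibrium₁ b a, equilibrium₁ (-b) (-a)} : Set So4),
            M ∈ orbit c₁ c₂ ∧ rigidBodyField l M = 0 ∧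
            ¬ IsNonlinearlyStableOn (rigidBodyField l) (orbit c₁ c₂) M ∧
            ¬ IsNonlinearlyStableOn (rigidBodyField l) Set.univ M) := by
  have hu := sq_strictAnti hl hpos
  refine ⟨bifurcationRoot₁ l, bifurcationRoot₂ l, bifurcationRoot₁_lt_bifurcationRoot₂ hu,
    bifurcationQuadratic_eq_zero_iff hu, fun c₁ c₂ a b _ hc₂ ha hb => ?_⟩
  obtain ⟨ha0, hba, h1, h2⟩ := orbit_parameters hc₂ ha hb
  -- The two equilibria are `M¹_{σb,σa}` with `σ = 1` and `σ = -1`.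
  have hratio : ∀ {σ : ℝ}, σ ^ 2 = 1 → (σ * b) ^ 2 / (σ * a) ^ 2 = b ^ 2 / a ^ 2 := fun hσ => by
    rw [mul_pow, mul_pow, hσ, one_mul, one_mul]
  have hne : ∀ {σ : ℝ}, σ ^ 2 = 1 → σ * a ≠ 0 := fun hσ =>
    mul_ne_zero (by rintro rfl; norm_num at hσ) ha0.ne'
  have hlt : ∀ {σ : ℝ}, σ ^ 2 = 1 → (σ * b) ^ 2 < (σ * a) ^ 2 := fun hσ => by
    rwa [mul_pow, mul_pow, hσ, one_mul, one_mul]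
  refine ⟨fun hr => ?_, fun hr M hM => ?_, fun hr M hM => ?_⟩
  · obtain ⟨p₃, p₄, h34, hroots, hneg⟩ := exists_lyapunovQuadratic_roots hpos hu ha0 hr
    refine ⟨p₃, p₄, h34, hroots, hneg, fun M hM => ?_⟩
    obtain ⟨σ, hσ, rfl⟩ := eq_equilibrium₁_of_mem hM
    have horb := equilibrium₁_mem_orbit hσ h1 h2
    have hcase : ∀ p ∈ Set.Ioo p₃ p₄, ∀ m n,
        fderiv ℝ (lyapunovCandidate l p m n) (equilibrium₁ (σ * b) (σ * a)) = 0 → _ :=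
      fun p hp m n hcrit => stable_of_lyapunovQuadratic_neg hpos hu horb (hne hσ)
        (by rwa [hratio hσ])
        (by rw [lyapunovQuadratic, mul_pow, mul_pow, hσ, one_mul, one_mul]
            exact (hneg p).2 hp) hcrit
    have hex : ∀ p, ∃ m n : ℝ,
        fderiv ℝ (lyapunovCandidate l p m n) (equilibrium₁ (σ * b) (σ * a)) = 0 :=
      fun p => exists_critical_multipliers (hlt hσ).ne l 1 _
    obtain ⟨p, hp⟩ := exists_between h34
    obtain ⟨m, n, hmn⟩ := hex p
    have hstab := (hcase p hp m n hmn).1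
    exact ⟨horb, rigidBodyField_equilibrium₁ l _ _, hstab _, hstab _,
      fun p hp => ⟨hex p, fun m n hmn => (hcase p hp m n hmn).2⟩⟩
  · obtain ⟨σ, hσ, rfl⟩ := eq_equilibrium₁_of_mem hM
    obtain ⟨δ, hdet, -, hδ⟩ := transverse_hyperbolic_or_double_root hpos hl hu (s := σ * b) (hne hσ)
    obtain ⟨hδ0, htr⟩ := hδ ((hratio hσ).trans hr)
    exact ⟨equilibrium₁_mem_orbit hσ h1 h2, rigidBodyField_equilibrium₁ l _ _,
      isSpectrallyStable_of_double_root hδ0 htr hdet, fun μ₁ μ₂ m n hcrit =>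
      not_definite_of_ratio_eq hpos hu (hne hσ) (hlt hσ) ((hratio hσ).trans hr) hcrit⟩
  · obtain ⟨σ, hσ, rfl⟩ := eq_equilibrium₁_of_mem hM
    obtain ⟨δ, hdet, hδ, -⟩ := transverse_hyperbolic_or_double_root hpos hl hu (s := σ * b) (hne hσ)
    obtain ⟨hδ0, htr⟩ := hδ ((hratio hσ).trans_lt hr.2)
    have hunst := not_isNonlinearlyStableOn_of_hyperbolic hpos hσ ha0 hba h1 h2 hδ0 hdet htr
    refine ⟨equilibrium₁_mem_orbit hσ h1 h2, rigidBodyField_equilibrium₁ l _ _, hunst,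
      fun h => hunst fun ε hε => ?_⟩
    obtain ⟨δ', hδ', h⟩ := h ε hε
    exact ⟨δ', hδ', fun γ hγ _ => h γ hγ (Set.mem_univ _)⟩
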